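/- Let $N \ge 1$ be an integer and let $\mathrm{d}U$ be the Haar probability measure on the unitary group $\mathrm{U}(N)$. For $z \in \mathbb{C}$ and $A,B \in \mathrm{Mat}_N(\mathbb{C})$ put $$I_N = \int_{\mathrm{U}(N)} e^{zN\operatorname{Tr}(AUBU^{-1})}\,\mathrm{d}U, \qquad J_N = \int_{\mathrm{U}(N)} e^{zN\operatorname{Tr}(AU+BU^{-1})}\,\mathrm{d}U.$$ *Notation.* For a Young diagram (partition) $\alpha \vdash d$ with $\ell(\alpha)$ rows of lengths $\alpha_i$, let $p_\alpha(x_1,\dots,x_N)=\prod_{i=1}^{\ell(\alpha)}\sum_{j=1}^N x_j^{\alpha_i}$, and let $C_\alpha \subset \mathrm{S}(d)$ be the conjugacy class of permutations of cycle type $\alpha$. For $\lambda \vdash d$ let $\mathsf{V}^\lambda$ be the corresponding irreducible complex representation of the symmetric group $\mathrm{S}(d)$, let $\chi_\alpha(\lambda)$ be the value of its character on $C_\alpha$, and let $$\omega_\alpha(\lambda) = \frac{|C_\alpha|\,\chi_\alpha(\lambda)}{\dim \mathsf{V}^\lambda}.$$ For $\lambda\vdash d$ with $\ell(\lambda)\le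 N$ let $\mathsf{W}^\lambda$ be the corresponding irreducible polynomial representation of $\mathrm{GL}_N(\mathbb{C})$ and let $$\Omega_N(\lambda) = \frac{d!}{N^d}\,\frac{\dim \mathsf{W}^\lambda}{\dim \mathsf{V}^\lambda}.$$ Let $\mathrm{S}_N(d)\subseteq \mathrm{S}(d)$ be the set of permutations with no increasing subsequence of length $N+1$, let $\mathbf{P}(\mathrm{LIS}_d\le N)=|\mathrm{S}_N(d)|/d!$ be the probability that a uniformly random permutation in $\mathrm{S}(d)$ lies in it, and for a function $f$ on the Young diagrams with $d$ cells and at most $N$ rows let $$\langle f\rangle = \sum_{\substack{\lambda\vdash d\\ \ell(\lambda)\le N}} f(\lambda)\,\frac{(\dim \mathsf{V}^\lambda)^2}{|\mathrm{S}_N(d)|}$$ be its expectation under the row-restricted Plancherel measure. *Theorem.* For all $z \in \mathbb{C}$ and $A,B\in\mathrm{Mat}_N(\mathbb{C})$, if $a_1,\dots,a_N$, $b_1,\dots,b_N$ and $c_1,\dots,c_N$ are the eigenvalues, with algebraic multiplicity, of $A$, $B$ and $C=AB$, respectively, then $$I_N = 1+\sum_{d=1}^\infty \frac{z^d}{d!}\,\mathbf{P}(\mathrm{LIS}_d\le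 N)\sum_{\alpha,\beta\vdash d} p_\alpha(a_1,\dots,a_N)\,p_\beta(b_1,\dots,b_N)\,\langle\omega_\alpha\Omega_N^{-1}\omega_\beta\rangle,$$ $$J_N = 1+\sum_{d=1}^\infty \frac{z^{2d}}{d!}\,N^d\,\mathbf{P}(\mathrm{LIS}_d\le N)\sum_{\beta\vdash d} p_\beta(c_1,\dots,c_N)\,\langle\Omega_N^{-1}\omega_\beta\rangle.$$ Moreover, these series in $d$ converge absolutely, and uniformly on compact subsets of $\mathbb{C}^{2N+1}$ (as functions of $(z,a_1,\dots,a_N,b_1,\dots,b_N)$) and of $\mathbb{C}^{N+1}$ (as functions of $(z,c_1,\dots,c_N)$), respectively. -/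

import Mathlib

open MeasureTheory Filter

noncomputable section

namespace StringExpansion

/-! ### Haar measure on the unitary group -/

/-- The compact group `U(N)` of `N × N` complex unitary matrices. -/
abbrev UGroup (N : ℕ) : Type := Matrix.unitaryGroup (Fin N) ℂ

instance instCompactSpaceUGroup (N : ℕ) : CompactSpace (UGroup N) := by
  refine isCompact_iff_compactSpace.1
    (?_ : IsCompact (↑(Matrix.unitaryGroup (Fin N) ℂ) : Set (Matrix (Fin N) (Fin N) ℂ)))
  have hK : IsCompact (Set.pi Set.univ (fun _ : Fin N =>
      Set.pi Set.univ (fun _ : Fin N => Metric.closedBall (0 : ℂ) 1))) :=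
    isCompact_univ_pi fun _ => isCompact_univ_pi fun _ => isCompact_closedBall _ _
  refine hK.of_isClosed_subset ?_ ?_
  · have h : (↑(Matrix.unitaryGroup (Fin N) ℂ) : Set (Matrix (Fin N) (Fin N) ℂ)) =
        {M | M * star M = 1} := by
      ext M
      exact Matrix.mem_unitaryGroup_iff
    rw [h]
    exact isClosed_eq (by fun_prop) continuous_const
  · intro M hM i _ j _
    simpa using entry_norm_bound_of_unitary hM i j

instance instMeasurableSpaceUGroup (N : ℕ) : MeasurableSpace (UGroup N) := borel _

instance instBorelSpaceUGroup (N : ℕ) : BorelSpace (UGroup N) := ⟨rfl⟩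

/-- Haar measure on `U(N)`, normalized to have total mass one. -/
def haarU (N : ℕ) : Measure (UGroup N) :=
  Measure.haarMeasure (⊤ : TopologicalSpace.PositiveCompacts (UGroup N))

/-- The Harish-Chandra/Itzykson-Zuber integral `∫ exp (z N Tr (A U B U⁻¹)) dU`. -/
def hciz (N : ℕ) (z : ℂ) (A B : Matrix (Fin N) (Fin N) ℂ) : ℂ :=
  ∫ U : UGroup N, Complex.exp (z * N * Matrix.trace
    (A * (U : Matrix (Fin N) (Fin N) ℂ) * B * ((U⁻¹ : UGroup N) : Matrix (Fin N) (Fin N) ℂ)))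
    ∂haarU N

/-- The Brézin-Gross-Witten integral `∫ exp (z N Tr (A U + B U⁻¹)) dU`. -/
def bgw (N : ℕ) (z : ℂ) (A B : Matrix (Fin N) (Fin N) ℂ) : ℂ :=
  ∫ U : UGroup N, Complex.exp (z * N * Matrix.trace
    (A * (U : Matrix (Fin N) (Fin N) ℂ) + B * ((U⁻¹ : UGroup N) : Matrix (Fin N) (Fin N) ℂ)))
    ∂haarU N

/-- `a` lists the eigenvalues of `A`, with algebraic multiplicity. -/
def IsEigenvalueList {N : ℕ} (A : Matrix (Fin N) (Fin N) ℂ) (a : Fin N → ℂ) : Prop :=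
  A.charpoly = ∏ i, (Polynomial.X - Polynomial.C (a i))

/-- The Newton power sum `p_α(x_1, …, x_N)`. -/
def powerSum {N d : ℕ} (α : d.Partition) (x : Fin N → ℂ) : ℂ :=
  MvPolynomial.eval x (MvPolynomial.psumPart (Fin N) ℂ α)

/-! ### Increasing subsequences -/

open scoped Classical in
/-- The length of the longest increasing subsequence of a permutation. -/
def lis {d : ℕ} (σ : Equiv.Perm (Fin d)) : ℕ :=
  (Finset.univ.filter fun s : Finset (Fin d) => StrictMonoOn σ (s : Set (Fin d))).sup Finset.card

/-- The permutations of `d` points with no increasing subsequence of length `N + 1`. -/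
def lisPerms (N d : ℕ) : Finset (Equiv.Perm (Fin d)) :=
  Finset.univ.filter fun σ => lis σ ≤ N

/-- The probability that a uniformly random permutation in `S(d)` has no increasing subsequence
of length `N + 1`. -/
def probLIS (N d : ℕ) : ℝ := ((lisPerms N d).card : ℝ) / (Nat.factorial d : ℝ)

/-! ### Irreducible representations of the symmetric group -/

/-- The group algebra of `S(d)`. -/
abbrev GroupAlg (d : ℕ) : Type := MonoidAlgebra ℂ (Equiv.Perm (Fin d))

/-- The row lengths of the Young diagram `lam`, in weakly decreasing order. The associated blocks
of `Fin d` are the rows of the tableau of shape `lam` numbered in reading order. -/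
def rows {d : ℕ} (lam : d.Partition) : Composition d where
  blocks := lam.parts.sort (· ≥ ·)
  blocks_pos := fun {i} hi => lam.parts_pos ((Multiset.mem_sort _).1 hi)
  blocks_sum := by
    rw [← Multiset.sum_coe, Multiset.sort_eq, lam.parts_sum]

/-- The row containing the entry `i` of the reading-order tableau of shape `lam`. -/
def rowOf {d : ℕ} (lam : d.Partition) (i : Fin d) : ℕ := ((rows lam).index i : ℕ)

/-- The column containing the entry `i` of the reading-order tableau of shape `lam`. -/
def colOf {d : ℕ} (lam : d.Partition) (i : Fin d) : ℕ := ((rows lam).invEmbedding i : ℕ)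

/-- The Young symmetrizer: the sum of the permutations that preserve rows, times the signed sum of
the permutations that preserve columns. -/
def youngSymmetrizer {d : ℕ} (lam : d.Partition) : GroupAlg d :=
  (∑ p : Equiv.Perm (Fin d) with ∀ i, rowOf lam (p i) = rowOf lam i,
      MonoidAlgebra.single p (1 : ℂ)) *
  (∑ q : Equiv.Perm (Fin d) with ∀ i, colOf lam (q i) = colOf lam i,
      MonoidAlgebra.single q (((Equiv.Perm.sign q : ℤˣ) : ℤ) : ℂ))

/-- The irreducible representation `V^lam` of `S(d)`, realized as the left ideal of the group
algebra generated by the Young symmetrizer. -/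
abbrev irrepV {d : ℕ} (lam : d.Partition) : Submodule (GroupAlg d) (GroupAlg d) :=
  Submodule.span (GroupAlg d) {youngSymmetrizer lam}

/-- The dimension of `V^lam`. -/
def dimV {d : ℕ} (lam : d.Partition) : ℕ := Module.finrank ℂ (irrepV lam)

/-- The character of `V^lam` at the permutation `σ`. -/
def character {d : ℕ} (lam : d.Partition) (σ : Equiv.Perm (Fin d)) : ℂ :=
  LinearMap.trace ℂ (irrepV lam)
    (Algebra.lsmul ℂ ℂ (irrepV lam) (MonoidAlgebra.of ℂ (Equiv.Perm (Fin d)) σ))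

/-- The conjugacy class `C_α` of permutations of cycle type `α` (fixed points included). -/
def conjClass {d : ℕ} (α : d.Partition) : Finset (Equiv.Perm (Fin d)) :=
  Finset.univ.filter fun σ => σ.partition.parts = α.parts

/-- The central character `ω_α(lam) = |C_α| χ_α(lam) / dim V^lam`; the product `|C_α| χ_α(lam)` is
written as the sum of the character, a class function, over `C_α`. -/
def omega {d : ℕ} (α lam : d.Partition) : ℂ :=
  (∑ σ ∈ conjClass α, character lam σ) / (dimV lam : ℂ)

/-! ### Irreducible polynomial representations of the general linear group -/

/-- The tensor space `(ℂ^N)^{⊗ d}`. -/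
abbrev TensorSpace (N d : ℕ) : Type := PiTensorProduct ℂ (fun _ : Fin d => Fin N → ℂ)

/-- The action of `S(d)` on `(ℂ^N)^{⊗ d}` by permutation of the tensor factors. -/
def permTensor (N d : ℕ) : Equiv.Perm (Fin d) →* Module.End ℂ (TensorSpace N d) where
  toFun σ := (PiTensorProduct.reindex ℂ (fun _ : Fin d => Fin N → ℂ) σ).toLinearMap
  map_one' := by
    ext x
    simp
    rfl
  map_mul' σ τ := by
    ext x
    simp
    rfl

/-- The irreducible polynomial representation `W^lam` of `GL_N(ℂ)`, realized as the image of the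
Young symmetrizer on `(ℂ^N)^{⊗ d}`, on which `g ∈ GL_N(ℂ)` acts as `g^{⊗ d}` (this commutes with
the Young symmetrizer). -/
abbrev irrepW (N : ℕ) {d : ℕ} (lam : d.Partition) : Submodule ℂ (TensorSpace N d) :=
  LinearMap.range (MonoidAlgebra.lift ℂ (Module.End ℂ (TensorSpace N d)) (Equiv.Perm (Fin d))
    (permTensor N d) (youngSymmetrizer lam))

/-- The dimension of `W^lam`. -/
def dimW (N : ℕ) {d : ℕ} (lam : d.Partition) : ℕ := Module.finrank ℂ (irrepW N lam)

/-- `Ω_N(lam) = (d! / N^d) (dim W^lam / dim V^lam)`. -/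
def Omega (N : ℕ) {d : ℕ} (lam : d.Partition) : ℂ :=
  ((Nat.factorial d : ℂ) / (N : ℂ) ^ d) * ((dimW N lam : ℂ) / (dimV lam : ℂ))

/-! ### String expansions -/

/-- The expectation `⟨f⟩` with respect to the row-restricted Plancherel measure, which gives mass
`(dim V^lam)² / |S_N(d)|` to each Young diagram with `d` cells and at most `N` rows. -/
def plancherel (N d : ℕ) (f : d.Partition → ℂ) : ℂ :=
  ∑ lam : d.Partition with lam.parts.card ≤ N,
    f lam * ((dimV lam : ℂ) ^ 2 / ((lisPerms N d).card : ℂ))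

/-- The degree `d` term of the string expansion of the HCIZ integral, as a function on
`ℂ^{2N+1}`. -/
def hcizTerm (N d : ℕ) (x : ℂ × (Fin N → ℂ) × (Fin N → ℂ)) : ℂ :=
  x.1 ^ d / (Nat.factorial d : ℂ) * (probLIS N d : ℂ) *
    ∑ α : d.Partition, ∑ β : d.Partition, powerSum α x.2.1 * powerSum β x.2.2 *
      plancherel N d (fun lam => omega α lam * (Omega N lam)⁻¹ * omega β lam)

/-- The degree `d` term of the string expansion of the BGW integral, as a function on
`ℂ^{N+1}`. -/
def bgwTerm (N d : ℕ) (x : ℂ × (Fin N → ℂ)) : ℂ :=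
  x.1 ^ (2 * d) / (Nat.factorial d : ℂ) * (N : ℂ) ^ d * (probLIS N d : ℂ) *
    ∑ β : d.Partition, powerSum β x.2 *
      plancherel N d (fun lam => (Omega N lam)⁻¹ * omega β lam)

/-- The series `∑_{d ≥ 1} f d` converges absolutely at each point, and both it and the series of
absolute values converge uniformly on every compact set. -/
def ConvergesAbsUnifOnCompacts {X : Type*} [TopologicalSpace X] (f : ℕ → X → ℂ) : Prop :=
  (∀ x, Summable fun d : ℕ => ‖f (d + 1) x‖) ∧
  ∀ K : Set X, IsCompact K →
    TendstoUniformlyOn (fun (n : ℕ) x => ∑ d ∈ Finset.range n, ‖f (d + 1) x‖)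
      (fun x => ∑' d : ℕ, ‖f (d + 1) x‖) atTop K ∧
    TendstoUniformlyOn (fun (n : ℕ) x => ∑ d ∈ Finset.range n, f (d + 1) x)
      (fun x => ∑' d : ℕ, f (d + 1) x) atTop K

end StringExpansion

end

/-!
The average of `U^{⊗d} X U^{-⊗d}` over `U(N)` commutes with every `U^{⊗d}`, so it lies in the
image of the group algebra of `S(d)` on the tensor space. Its coefficients there are found by
inverting the trace form of that image, and the inverse is diagonal in the basis of central
idempotents attached to the Young symmetrizers: this is the Weingarten element, and the weights
`dim V / dim W` are the source of `Ω_N⁻¹`. Traces of permutations against tensor powers are power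
sums of eigenvalues, which gives every moment of `Tr (A U B U⁻¹)` and of `Tr (A U + B U⁻¹)`; in
the latter case, scalar unitary matrices kill the terms with unequal numbers of `U` and `U⁻¹`.
Summing the exponential series under the integral sign gives the expansions. Since the terms only
depend on the eigenvalues, they can be evaluated at diagonal matrices, where they are integrals of
the terms of an exponential series over a compact group; hence the uniform convergence.
-/

noncomputable section

namespace StringExpansion

open scoped Finset
open MonoidAlgebra (single)

/-! ### Rows and columns of the reading-order tableau -/

section Tableaux

variable {d : ℕ} {lam mu : d.Partition}

lemma colOf_eq (lam : d.Partition) (i : Fin d) :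
    colOf lam i = i - (rows lam).sizeUpTo (rowOf lam i) :=
  (rows lam).coe_invEmbedding i

lemma colOf_lt (lam : d.Partition) (i : Fin d) : colOf lam i < d := by
  rw [colOf_eq]
  omega

lemma injective_rowOf_colOf (lam : d.Partition) :
    Function.Injective fun i => (rowOf lam i, colOf lam i) := by
  intro i j hij
  obtain ⟨hrow, hcol⟩ := Prod.mk.inj hij
  have hi : (rows lam).sizeUpTo (rowOf lam i) ≤ i := (rows lam).sizeUpTo_index_le i
  have hj : (rows lam).sizeUpTo (rowOf lam j) ≤ j := (rows lam).sizeUpTo_index_le j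
  rw [colOf_eq, colOf_eq, hrow] at hcol
  rw [hrow] at hi
  ext
  omega

lemma exists_rowOf_eq_colOf_eq_iff {r c : ℕ} :
    (∃ i, rowOf lam i = r ∧ colOf lam i = c) ↔
      ∃ h : r < (rows lam).blocks.length, c < (rows lam).blocks[r] := by
  constructor
  · rintro ⟨i, rfl, rfl⟩
    exact ⟨((rows lam).index i).2, ((rows lam).invEmbedding i).2⟩
  · rintro ⟨hr, hc⟩
    refine ⟨(rows lam).embedding ⟨r, hr⟩ ⟨c, hc⟩, ?_, ?_⟩
    · rw [rowOf, Composition.index_embedding]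
    · rw [colOf, Composition.invEmbedding_comp]

lemma exists_rowOf_eq_of_le (i : Fin d) {r : ℕ} (hr : r ≤ rowOf lam i) :
    ∃ j, rowOf lam j = r ∧ colOf lam j = colOf lam i := by
  obtain ⟨h, hc⟩ := exists_rowOf_eq_colOf_eq_iff.1 ⟨i, rfl, rfl⟩
  refine exists_rowOf_eq_colOf_eq_iff.2 ⟨hr.trans_lt h, hc.trans_le ?_⟩
  rcases hr.eq_or_lt with rfl | hlt
  · exact le_rfl
  · exact List.pairwise_iff_getElem.1 (Multiset.pairwise_sort lam.parts (· ≥ ·)) r _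
      (hr.trans_lt h) h hlt

lemma eq_range_card_of_isLowerSet {s : Finset ℕ} (hs : IsLowerSet (s : Set ℕ)) :
    s = Finset.range #s := by
  refine Finset.eq_of_subset_of_card_le (fun a ha => ?_) (by simp)
  have hsub : Finset.range (a + 1) ⊆ s := fun b hb =>
    hs (Nat.lt_succ_iff.1 (Finset.mem_range.1 hb)) ha
  simpa using Finset.card_le_card hsub

/-- The length of column `j` of the Young diagram `lam`, that is, the part `lam'_j` of the
conjugate partition (columns are numbered from `0`). -/
def colLength (lam : d.Partition) (j : ℕ) : ℕ := #{i | colOf lam i = j}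

lemma lt_colLength_iff {r j : ℕ} :
    r < colLength lam j ↔ ∃ i, rowOf lam i = r ∧ colOf lam i = j := by
  have hinj : Set.InjOn (rowOf lam) ({i | colOf lam i = j} : Finset (Fin d)) := fun x hx y hy hxy =>
    injective_rowOf_colOf lam (Prod.ext hxy ((Finset.mem_filter_univ x).1 hx |>.trans
      ((Finset.mem_filter_univ y).1 hy).symm))
  have himage : ({i | colOf lam i = j} : Finset (Fin d)).image (rowOf lam) =
      Finset.range (colLength lam j) := by
    rw [colLength, ← Finset.card_image_of_injOn hinj]
    refine eq_range_card_of_isLowerSet fun a b hba ha => ?_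
    simp only [Finset.coe_image, Finset.coe_filter, Finset.mem_univ, true_and, Set.mem_image,
      Set.mem_ofPred_eq] at ha ⊢
    obtain ⟨i, hi, rfl⟩ := ha
    obtain ⟨x, hxrow, hxcol⟩ := exists_rowOf_eq_of_le i hba
    exact ⟨x, hxcol.trans hi, hxrow⟩
  rw [← Finset.mem_range, ← himage]
  simp [and_comm]

lemma card_rowOf_lt_and_colOf_eq (lam : d.Partition) (k j : ℕ) :
    #{i | rowOf lam i < k ∧ colOf lam i = j} = min k (colLength lam j) := by
  have hinj : Set.InjOn (rowOf lam)
      ({i | rowOf lam i < k ∧ colOf lam i = j} : Finset (Fin d)) := fun x hx y hy hxy =>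
    injective_rowOf_colOf lam (Prod.ext hxy (((Finset.mem_filter_univ x).1 hx).2.trans
      ((Finset.mem_filter_univ y).1 hy).2.symm))
  rw [← Finset.card_image_of_injOn hinj, ← Finset.card_range (min k _)]
  congr 1
  ext r
  simp only [Finset.mem_image, Finset.mem_filter_univ, Finset.mem_range, lt_min_iff,
    lt_colLength_iff]
  grind

lemma card_parts_eq_colLength_zero (lam : d.Partition) : lam.parts.card = colLength lam 0 := by
  have hlength : (rows lam).blocks.length = lam.parts.card := Multiset.length_sort _
  refine eq_of_forall_lt_iff fun r => ?_
  rw [lt_colLength_iff, exists_rowOf_eq_colOf_eq_iff, ← hlength]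
  exact ⟨fun h => ⟨h, (rows lam).blocks_pos' r h⟩, fun ⟨h, _⟩ => h⟩

lemma rowOf_lt_iff {k : ℕ} {i : Fin d} :
    rowOf lam i < k ↔ (i : ℕ) < (rows lam).sizeUpTo k := by
  refine ⟨fun h => ((rows lam).lt_sizeUpTo_index_succ i).trans_le
    ((rows lam).monotone_sizeUpTo h), fun h => ?_⟩
  by_contra! hk
  exact absurd (((rows lam).monotone_sizeUpTo hk).trans ((rows lam).sizeUpTo_index_le i))
    (not_le.2 h)

lemma card_rowOf_lt (lam : d.Partition) (k : ℕ) :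
    #{i | rowOf lam i < k} = (rows lam).sizeUpTo k := by
  simp only [rowOf_lt_iff]
  rw [Fin.card_filter_val_lt, min_eq_right ((rows lam).sizeUpTo_le k)]

lemma list_eq_of_sum_take_eq : ∀ {l m : List ℕ}, (∀ x ∈ l, 0 < x) → (∀ x ∈ m, 0 < x) →
    (∀ k, (l.take k).sum = (m.take k).sum) → l = m
  | [], [], _, _, _ => rfl
  | [], b :: m, _, hm, h => absurd (hm b (by simp)) (by simpa using (h 1).ge)
  | a :: l, [], hl, _, h => absurd (hl a (by simp)) (by simpa using (h 1).le)
  | a :: l, b :: m, hl, hm, h => by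
    obtain rfl : a = b := by simpa using h 1
    exact congrArg (a :: ·) (list_eq_of_sum_take_eq (fun x hx => hl x (by simp [hx]))
      (fun x hx => hm x (by simp [hx])) fun k => by simpa using h (k + 1))

lemma partition_eq_of_card_rowOf_lt
    (h : ∀ k, #{i | rowOf lam i < k} = #{i | rowOf mu i < k}) : lam = mu := by
  have hblocks : (rows lam).blocks = (rows mu).blocks :=
    list_eq_of_sum_take_eq (fun _ => (rows lam).blocks_pos) (fun _ => (rows mu).blocks_pos)
      fun k => by simpa only [card_rowOf_lt, Composition.sizeUpTo] using h k
  ext1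
  rw [← Multiset.sort_eq lam.parts (· ≥ ·), ← Multiset.sort_eq mu.parts (· ≥ ·)]
  exact congrArg _ hblocks

/-- No two entries in a row of the tableau of shape `lam` lie in a common column of the tableau
`g T`, where `T` is the reading-order tableau of shape `mu`. This is the condition under which the
product of the row symmetrizer of the first and the column antisymmetrizer of the second can be
nonzero. -/
def RowColSeparated (lam mu : d.Partition) (g : Equiv.Perm (Fin d)) : Prop :=
  Function.Injective fun i => (rowOf lam i, colOf mu (g⁻¹ i))

lemma card_colOf_comp_perm (mu : d.Partition) (g : Equiv.Perm (Fin d)) (j : ℕ) :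
    #{i | colOf mu (g i) = j} = colLength mu j :=
  Finset.card_equiv g fun i => by simp

lemma card_filter_lt_and_eq_le_min {ι κ : Type*} [Fintype ι] [DecidableEq κ] {f : ι → ℕ}
    {h : ι → κ} (hinj : Function.Injective fun i => (f i, h i)) (k : ℕ) (c : κ) :
    #{i | f i < k ∧ h i = c} ≤ min k #{i | h i = c} := by
  refine le_min ?_ (Finset.card_le_card fun i => by simp)
  calc #{i | f i < k ∧ h i = c} ≤ #(Finset.range k) :=
        Finset.card_le_card_of_injOn f (fun i => by simp +contextual) fun x hx y hy hxy =>
          hinj (Prod.ext hxy (((Finset.mem_filter_univ x).1 hx).2.trans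
            ((Finset.mem_filter_univ y).1 hy).2.symm))
    _ = k := Finset.card_range k

lemma card_filter_eq_sum_range {ι : Type*} [Fintype ι] (p : ι → Prop) [DecidablePred p]
    {h : ι → ℕ} {M : ℕ} (hM : ∀ i, h i < M) :
    #{i | p i} = ∑ j ∈ Finset.range M, #{i | p i ∧ h i = j} := by
  rw [Finset.card_eq_sum_card_fiberwise (f := h) (t := Finset.range M)
    fun i _ => by simpa using hM i]
  simp only [Finset.filter_filter]

namespace RowColSeparated

variable {g : Equiv.Perm (Fin d)}

lemma card_column_le (h : RowColSeparated lam mu g) (k j : ℕ) :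
    #{i | rowOf lam i < k ∧ colOf mu (g⁻¹ i) = j} ≤ #{i | rowOf mu i < k ∧ colOf mu i = j} := by
  refine (card_filter_lt_and_eq_le_min h k j).trans ?_
  rw [card_colOf_comp_perm, card_rowOf_lt_and_colOf_eq]

lemma card_rowOf_lt_le (h : RowColSeparated lam mu g) (k : ℕ) :
    #{i | rowOf lam i < k} ≤ #{i | rowOf mu i < k} := by
  rw [card_filter_eq_sum_range _ fun i => colOf_lt mu (g⁻¹ i),
    card_filter_eq_sum_range _ (colOf_lt mu)]
  exact Finset.sum_le_sum fun j _ => h.card_column_le k j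

-- For equal shapes every inequality in `card_column_le` is an equality, because the totals agree.
lemma rowOf_lt_colLength (h : RowColSeparated lam lam g) (i : Fin d) :
    rowOf lam i < colLength lam (colOf lam (g⁻¹ i)) := by
  set j := colOf lam (g⁻¹ i) with hj
  set k := colLength lam j
  have hsum : ∑ j' ∈ Finset.range d, #{i | rowOf lam i < k ∧ colOf lam (g⁻¹ i) = j'} =
      ∑ j' ∈ Finset.range d, #{i | rowOf lam i < k ∧ colOf lam i = j'} := by
    rw [← card_filter_eq_sum_range _ fun i => colOf_lt lam (g⁻¹ i),
      ← card_filter_eq_sum_range _ (colOf_lt lam)]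
  have hcard : #{i | rowOf lam i < k ∧ colOf lam (g⁻¹ i) = j} = k := by
    rw [(Finset.sum_eq_sum_iff_of_le fun j' _ => h.card_column_le k j').1 hsum j
      (Finset.mem_range.2 (colOf_lt lam _)), card_rowOf_lt_and_colOf_eq, min_self]
  have hcolumn : ({i | rowOf lam i < k ∧ colOf lam (g⁻¹ i) = j} : Finset (Fin d)) =
      ({i | colOf lam (g⁻¹ i) = j} : Finset (Fin d)) :=
    Finset.eq_of_subset_of_card_le (Finset.monotone_filter_right _ fun _ _ hx => hx.2)
      ((card_colOf_comp_perm lam g⁻¹ j).trans hcard.symm).le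
  have hi := (Finset.ext_iff.1 hcolumn i).2 (by simp [hj])
  exact ((Finset.mem_filter_univ i).1 hi).1

lemma exists_eq_mul (h : RowColSeparated lam lam g) :
    ∃ p q : Equiv.Perm (Fin d), (∀ i, rowOf lam (p i) = rowOf lam i) ∧
      (∀ i, colOf lam (q i) = colOf lam i) ∧ g = p * q := by
  choose φ hrow hcol using fun i => lt_colLength_iff.1 (h.rowOf_lt_colLength i)
  have hφ : Function.Injective φ := fun x y hxy =>
    h (Prod.ext ((hrow x).symm.trans (hxy ▸ hrow y)) ((hcol x).symm.trans (hxy ▸ hcol y)))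
  let p : Equiv.Perm (Fin d) := Equiv.ofBijective φ (Finite.injective_iff_bijective.1 hφ)
  have hp (i) : p i = φ i := rfl
  refine ⟨p⁻¹, p * g, fun i => ?_, fun i => ?_, by group⟩
  · rw [← hrow (p⁻¹ i), ← hp, ← Equiv.Perm.mul_apply, mul_inv_cancel, Equiv.Perm.one_apply]
  · rw [Equiv.Perm.mul_apply, hp, hcol, ← Equiv.Perm.mul_apply, inv_mul_cancel,
      Equiv.Perm.one_apply]

lemma eq_of_symm {g' : Equiv.Perm (Fin d)} (h : RowColSeparated lam mu g)
    (h' : RowColSeparated mu lam g') : lam = mu :=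
  partition_eq_of_card_rowOf_lt fun k => (h.card_rowOf_lt_le k).antisymm (h'.card_rowOf_lt_le k)

end RowColSeparated

end Tableaux

/-! ### The center of a group algebra -/

section GroupAlgebra

lemma sum_coeff_smul_single {k G : Type*} [Semiring k] [Fintype G] (x : MonoidAlgebra k G) :
    ∑ g, x.coeff g • single g (1 : k) = x := by
  simpa [MonoidAlgebra.basis] using (MonoidAlgebra.basis G k).sum_repr x

lemma trace_eq_sum_coeff {k G : Type*} [CommRing k] [Fintype G]
    (f : Module.End k (MonoidAlgebra k G)) :
    LinearMap.trace k _ f = ∑ g, (f (single g 1)).coeff g := by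
  classical
  rw [LinearMap.trace_eq_matrix_trace k (MonoidAlgebra.basis G k), Matrix.trace]
  refine Finset.sum_congr rfl fun g _ => ?_
  rw [Matrix.diag_apply, LinearMap.toMatrix_apply, MonoidAlgebra.basis_apply]
  rfl

section Center

variable {k G : Type*} [CommSemiring k] [Group G]

lemma mem_center_of_commute_single {x : MonoidAlgebra k G}
    (h : ∀ g, single g 1 * x = x * single g 1) : x ∈ Subalgebra.center k (MonoidAlgebra k G) := by
  refine Subalgebra.mem_center_iff.2 fun y => ?_
  induction y using MonoidAlgebra.induction_on with
  | of g => exact h g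
  | add y z hy hz => rw [add_mul, mul_add, hy, hz]
  | smul c y hy => rw [smul_mul_assoc, mul_smul_comm, hy]

lemma coeff_eq_of_isConj {x : MonoidAlgebra k G} (hx : x ∈ Subalgebra.center k (MonoidAlgebra k G))
    {g h : G} (hgh : IsConj g h) : x.coeff g = x.coeff h := by
  obtain ⟨c, rfl⟩ := isConj_iff.1 hgh
  have := congrArg (fun z => z.coeff (c * g)) (Subalgebra.mem_center_iff.1 hx (single c 1))
  simpa only [MonoidAlgebra.coeff_single_mul_apply, MonoidAlgebra.coeff_mul_single_apply, one_mul,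
    mul_one, inv_mul_cancel_left] using this

lemma sum_single_mem_center {s : Finset G} (hs : ∀ g, ∀ x ∈ s, g * x * g⁻¹ ∈ s) :
    ∑ x ∈ s, single x (1 : k) ∈ Subalgebra.center k (MonoidAlgebra k G) := by
  refine mem_center_of_commute_single fun g => ?_
  rw [Finset.mul_sum, Finset.sum_mul]
  refine Finset.sum_equiv (MulAut.conj g).toEquiv (fun x => ⟨hs g x, fun hx => ?_⟩) fun x _ => ?_
  · simpa [mul_assoc] using hs g⁻¹ _ hx
  · simp [MonoidAlgebra.single_mul_single]

end Center

lemma finrank_center_le_card_conjClasses {k G : Type*} [Field k] [Group G]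
    [Finite (ConjClasses G)] :
    Module.finrank k (Subalgebra.center k (MonoidAlgebra k G)) ≤ Nat.card (ConjClasses G) := by
  have := Fintype.ofFinite (ConjClasses G)
  let f : Subalgebra.center k (MonoidAlgebra k G) →ₗ[k] ConjClasses G → k :=
    { toFun x C := x.1.coeff C.out
      map_add' _ _ := rfl
      map_smul' _ _ := rfl }
  have hf : Function.Injective f := fun x y hxy => by
    refine Subtype.ext (MonoidAlgebra.coeff_injective (Finsupp.ext fun g => ?_))
    have hg : IsConj (ConjClasses.mk g).out g :=
      ConjClasses.mk_eq_mk_iff_isConj.1 (Quotient.out_eq _)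
    rw [← coeff_eq_of_isConj x.2 hg, ← coeff_eq_of_isConj y.2 hg]
    exact congrFun hxy (ConjClasses.mk g)
  simpa using LinearMap.finrank_le_finrank_of_injective hf

variable {k G : Type*} [CommRing k] [Group G] [Fintype G]

lemma trace_mulRight (x : MonoidAlgebra k G) :
    LinearMap.trace k _ (LinearMap.mulRight k x) = Fintype.card G * x.coeff 1 := by
  rw [trace_eq_sum_coeff]
  simp [MonoidAlgebra.coeff_single_mul_apply]

/-- The sum of the conjugates of an element of the group algebra; up to a scalar this is the
projection of the group algebra to its center. -/
def conjSum (x : MonoidAlgebra k G) : MonoidAlgebra k G := ∑ g, single g 1 * x * single g⁻¹ 1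

lemma conjSum_mem_center (x : MonoidAlgebra k G) :
    conjSum x ∈ Subalgebra.center k (MonoidAlgebra k G) := by
  refine mem_center_of_commute_single fun h => ?_
  rw [conjSum, Finset.mul_sum, Finset.sum_mul]
  refine Fintype.sum_equiv (Equiv.mulLeft h) _ _ fun g => ?_
  simp only [Equiv.coe_mulLeft, ← mul_assoc, MonoidAlgebra.single_mul_single, one_mul]
  simp only [mul_assoc, MonoidAlgebra.single_mul_single, mul_inv_rev, inv_mul_cancel, mul_one]

lemma conjSum_mul {z : MonoidAlgebra k G} (hz : z ∈ Subalgebra.center k (MonoidAlgebra k G))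
    (x : MonoidAlgebra k G) : conjSum x * z = conjSum (x * z) := by
  rw [conjSum, conjSum, Finset.sum_mul]
  refine Finset.sum_congr rfl fun g _ => ?_
  rw [mul_assoc, Subalgebra.mem_center_iff.1 hz, ← mul_assoc, mul_assoc (single g 1)]

lemma coeff_conjSum (x : MonoidAlgebra k G) (h : G) :
    (conjSum x).coeff h =
      LinearMap.trace k _ (LinearMap.mulLeft k (single h⁻¹ 1) ∘ₗ LinearMap.mulRight k x) := by
  rw [trace_eq_sum_coeff, conjSum, MonoidAlgebra.coeff_sum, Finset.sum_apply']
  refine Finset.sum_congr rfl fun g _ => ?_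
  simp only [LinearMap.comp_apply, LinearMap.mulLeft_apply, LinearMap.mulRight_apply,
    MonoidAlgebra.coeff_mul_single_apply, MonoidAlgebra.coeff_single_mul_apply, inv_inv, one_mul,
    mul_one]

lemma map_conjSum_of_trace {M : Type*} [AddCommGroup M] [Module k M]
    {τ : MonoidAlgebra k G →ₗ[k] M} (hτ : ∀ x y, τ (x * y) = τ (y * x)) (x : MonoidAlgebra k G) :
    τ (conjSum x) = Fintype.card G • τ x := by
  have hconj (g : G) : τ (single g 1 * x * single g⁻¹ 1) = τ x := by
    rw [hτ, ← mul_assoc, MonoidAlgebra.single_mul_single, inv_mul_cancel, one_mul,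
      ← MonoidAlgebra.one_def, one_mul]
  simp only [conjSum, map_sum, hconj, Finset.sum_const, Finset.card_univ]

end GroupAlgebra

/-! ### Primitive quasi-idempotents -/

section QuasiIdempotent

variable {k : Type*} [Field k]

lemma trace_eq_mul_finrank_range {V : Type*} [AddCommGroup V] [Module k V]
    [FiniteDimensional k V] {f : Module.End k V} {c : k} (hc : c ≠ 0) (hf : f * f = c • f) :
    LinearMap.trace k V f = c * Module.finrank k (LinearMap.range f) := by
  have hproj : LinearMap.IsProj (LinearMap.range f) (c⁻¹ • f) := by
    refine ⟨fun v => ⟨c⁻¹ • v, map_smul f _ _⟩, ?_⟩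
    rintro _ ⟨v, rfl⟩
    rw [LinearMap.smul_apply, ← Module.End.mul_apply, hf, LinearMap.smul_apply,
      inv_smul_smul₀ hc]
  rw [← hproj.trace, map_smul, smul_eq_mul, mul_inv_cancel_left₀ hc]

lemma mem_span_singleton_iff_mul_eq {A : Type*} [Ring A] [Algebra k A] {e : A} {c : k}
    (hc : c ≠ 0) (he : e * e = c • e) {v : A} :
    v ∈ Submodule.span A {e} ↔ v * e = c • v := by
  rw [Submodule.mem_span_singleton]
  constructor
  · rintro ⟨a, rfl⟩
    rw [smul_eq_mul, mul_assoc, he, mul_smul_comm]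
  · intro h
    exact ⟨c⁻¹ • v, by rw [smul_eq_mul, smul_mul_assoc, h, inv_smul_smul₀ hc]⟩

lemma trace_lsmul_span_singleton {A : Type*} [Ring A] [Algebra k A] [FiniteDimensional k A]
    {e : A} {c : k} (hc : c ≠ 0) (he : e * e = c • e) (x : A) :
    LinearMap.trace k (Submodule.span A {e}) (Algebra.lsmul k k (Submodule.span A {e}) x) =
      c⁻¹ * LinearMap.trace k A (LinearMap.mulLeft k x ∘ₗ LinearMap.mulRight k e) := by
  set f : Module.End k A := c⁻¹ • (LinearMap.mulLeft k x ∘ₗ LinearMap.mulRight k e) with hf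
  have hmem (v : A) : f v ∈ (Submodule.span A {e}).restrictScalars k :=
    Submodule.mem_span_singleton.2 ⟨c⁻¹ • (x * v), by simp [hf, mul_assoc]⟩
  rw [← smul_eq_mul, ← map_smul, ← hf,
    ← LinearMap.trace_restrict_eq_of_forall_mem _ f hmem]
  congr 1
  refine LinearMap.ext fun v => Subtype.ext ?_
  calc x * v.1 = c⁻¹ • (x * (v.1 * e)) := by
        rw [(mem_span_singleton_iff_mul_eq hc he).1 v.2, mul_smul_comm, inv_smul_smul₀ hc]
    _ = _ := rfl

lemma trace_lsmul_of_mul_eq_smul {A : Type*} [Ring A] [Algebra k A] [FiniteDimensional k A]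
    {e x : A} (hx : x ∈ Subalgebra.center k A) {t : k} (ht : x * e = t • e) :
    LinearMap.trace k (Submodule.span A {e}) (Algebra.lsmul k k (Submodule.span A {e}) x) =
      t * Module.finrank k (Submodule.span A {e}) := by
  have hscalar : Algebra.lsmul k k (Submodule.span A {e}) x = t • 1 := by
    refine LinearMap.ext fun v => Subtype.ext ?_
    obtain ⟨a, ha⟩ := Submodule.mem_span_singleton.1 v.2
    change x * v.1 = t • v.1
    rw [← ha, smul_eq_mul, ← mul_assoc, ← Subalgebra.mem_center_iff.1 hx, mul_assoc, ht,
      mul_smul_comm]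
  rw [hscalar, map_smul, LinearMap.trace_one, smul_eq_mul]

variable {G : Type*} [Group G]

/-- A scalar multiple `e` of a primitive idempotent whose corner `e k[G] e` is spanned by `e`,
normalized so that the coefficient of the identity is one. -/
structure IsPrimitiveQuasiIdempotent (e : MonoidAlgebra k G) : Prop where
  coeff_one : e.coeff 1 = 1
  exists_mul_mul_eq_smul : ∀ x, ∃ t : k, e * x * e = t • e

/-- The scalar `c` with `e * e = c • e`, for a primitive quasi-idempotent `e`. -/
def quasiScalar (e : MonoidAlgebra k G) : k := (e * e).coeff 1

namespace IsPrimitiveQuasiIdempotent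

variable {e : MonoidAlgebra k G}

lemma mul_mul (he : IsPrimitiveQuasiIdempotent e) (x : MonoidAlgebra k G) :
    e * x * e = (e * x * e).coeff 1 • e := by
  obtain ⟨t, ht⟩ := he.exists_mul_mul_eq_smul x
  rw [ht, MonoidAlgebra.coeff_smul_apply, he.coeff_one, smul_eq_mul, mul_one]

lemma mul_self (he : IsPrimitiveQuasiIdempotent e) : e * e = quasiScalar e • e := by
  simpa only [mul_one, quasiScalar] using he.mul_mul 1

-- Both sides are the trace of the rank-one map `x ↦ e * x * e`.
lemma coeff_one_mul_conjSum [Fintype G] (he : IsPrimitiveQuasiIdempotent e) :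
    (e * conjSum e).coeff 1 = quasiScalar e ^ 2 := by
  let φ : MonoidAlgebra k G →ₗ[k] k := Finsupp.lapply 1 ∘ₗ
    (MonoidAlgebra.coeffLinearEquiv k).toLinearMap ∘ₗ LinearMap.mulRight k e ∘ₗ
      LinearMap.mulLeft k e
  have hφ (x) : φ x = (e * x * e).coeff 1 := rfl
  have hrank : φ.smulRight e = LinearMap.mulRight k e ∘ₗ LinearMap.mulLeft k e :=
    LinearMap.ext fun x => (he.mul_mul x).symm
  calc (e * conjSum e).coeff 1 = LinearMap.trace k _ (φ.smulRight e) := by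
        rw [hrank, trace_eq_sum_coeff, conjSum, Finset.mul_sum, MonoidAlgebra.coeff_sum,
          Finset.sum_apply']
        refine Finset.sum_congr rfl fun g _ => ?_
        simp [← mul_assoc, MonoidAlgebra.coeff_mul_single_apply]
    _ = quasiScalar e ^ 2 := by
        rw [LinearMap.trace_smulRight, hφ, he.mul_self, smul_mul_assoc, he.mul_self, smul_smul,
          MonoidAlgebra.coeff_smul_apply, he.coeff_one, smul_eq_mul, mul_one, pow_two]

variable [CharZero k]

lemma quasiScalar_ne_zero [Finite G] (he : IsPrimitiveQuasiIdempotent e) :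
    quasiScalar e ≠ 0 := by
  have := Fintype.ofFinite G
  intro h
  have hnil : IsNilpotent (LinearMap.mulRight k e) := by
    refine ⟨2, LinearMap.ext fun x => ?_⟩
    rw [pow_two, Module.End.mul_apply, LinearMap.mulRight_apply, LinearMap.mulRight_apply,
      mul_assoc, he.mul_self, h, zero_smul, mul_zero, LinearMap.zero_apply]
  have htrace := (LinearMap.isNilpotent_trace_of_isNilpotent hnil).eq_zero
  rw [trace_mulRight, he.coeff_one, mul_one] at htrace
  exact Nat.cast_ne_zero.2 Fintype.card_ne_zero htrace

lemma quasiScalar_mul_finrank [Fintype G] (he : IsPrimitiveQuasiIdempotent e) :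
    quasiScalar e * Module.finrank k (Submodule.span (MonoidAlgebra k G) {e}) =
      Fintype.card G := by
  have h := trace_lsmul_span_singleton he.quasiScalar_ne_zero he.mul_self 1
  rw [map_one, LinearMap.trace_one, LinearMap.mulLeft_one, LinearMap.id_comp, trace_mulRight,
    he.coeff_one, mul_one] at h
  rw [h, mul_inv_cancel_left₀ he.quasiScalar_ne_zero]

lemma finrank_span_ne_zero [Finite G] (he : IsPrimitiveQuasiIdempotent e) :
    (Module.finrank k (Submodule.span (MonoidAlgebra k G) {e}) : k) ≠ 0 :=
  have := Fintype.ofFinite G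
  right_ne_zero_of_mul (he.quasiScalar_mul_finrank ▸ Nat.cast_ne_zero.2 Fintype.card_ne_zero)

lemma mul_conjSum [Fintype G] (he : IsPrimitiveQuasiIdempotent e) :
    e * conjSum e = quasiScalar e ^ 2 • e := by
  obtain ⟨t, ht⟩ : ∃ t : k, e * conjSum e = t • e := by
    obtain ⟨t, ht⟩ := he.exists_mul_mul_eq_smul (conjSum e)
    refine ⟨(quasiScalar e)⁻¹ * t, ?_⟩
    rw [mul_smul, ← ht, mul_assoc, ← Subalgebra.mem_center_iff.1 (conjSum_mem_center e),
      ← mul_assoc, he.mul_self, smul_mul_assoc, inv_smul_smul₀ he.quasiScalar_ne_zero]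
  have hcoeff := he.coeff_one_mul_conjSum
  rw [ht, MonoidAlgebra.coeff_smul_apply, he.coeff_one, smul_eq_mul, mul_one] at hcoeff
  rw [ht, hcoeff]

end IsPrimitiveQuasiIdempotent

/-! ### Primitive central idempotents -/

variable [Fintype G]

/-- The primitive central idempotent of the block containing the primitive quasi-idempotent `e`. -/
def centralIdem (e : MonoidAlgebra k G) : MonoidAlgebra k G := (quasiScalar e ^ 2)⁻¹ • conjSum e

lemma centralIdem_mem_center (e : MonoidAlgebra k G) :
    centralIdem e ∈ Subalgebra.center k (MonoidAlgebra k G) :=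
  Subalgebra.smul_mem _ (conjSum_mem_center e) _

lemma centralIdem_mul_eq_zero {e f : MonoidAlgebra k G} (h : ∀ x, e * x * f = 0) :
    centralIdem e * centralIdem f = 0 := by
  have hzero : e * conjSum f = 0 := by
    rw [conjSum, Finset.mul_sum]
    exact Finset.sum_eq_zero fun g _ => by rw [← mul_assoc, ← mul_assoc, h, zero_mul]
  rw [centralIdem, centralIdem, smul_mul_smul_comm, conjSum_mul (conjSum_mem_center f), hzero]
  simp [conjSum]

namespace IsPrimitiveQuasiIdempotent

variable {e : MonoidAlgebra k G} [CharZero k]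

lemma centralIdem_mul (he : IsPrimitiveQuasiIdempotent e) : centralIdem e * e = e := by
  rw [← Subalgebra.mem_center_iff.1 (centralIdem_mem_center e), centralIdem, mul_smul_comm,
    he.mul_conjSum, inv_smul_smul₀ (pow_ne_zero 2 he.quasiScalar_ne_zero)]

lemma centralIdem_mul_self (he : IsPrimitiveQuasiIdempotent e) :
    centralIdem e * centralIdem e = centralIdem e := by
  calc centralIdem e * centralIdem e = (quasiScalar e ^ 2)⁻¹ • conjSum (e * centralIdem e) := by
        rw [← conjSum_mul (centralIdem_mem_center e), ← smul_mul_assoc, ← centralIdem]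
    _ = centralIdem e := by
        rw [Subalgebra.mem_center_iff.1 (centralIdem_mem_center e), he.centralIdem_mul,
          ← centralIdem]

lemma centralIdem_ne_zero (he : IsPrimitiveQuasiIdempotent e) : centralIdem e ≠ 0 := fun h => by
  have hcoeff := he.coeff_one
  rw [← he.centralIdem_mul, h, zero_mul] at hcoeff
  exact zero_ne_one hcoeff

lemma coeff_centralIdem (he : IsPrimitiveQuasiIdempotent e) (g : G) :
    (centralIdem e).coeff g = (quasiScalar e)⁻¹ * LinearMap.trace k _
      (Algebra.lsmul k k (Submodule.span (MonoidAlgebra k G) {e}) (single g⁻¹ (1 : k))) := by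
  rw [centralIdem, MonoidAlgebra.coeff_smul_apply, coeff_conjSum,
    trace_lsmul_span_singleton he.quasiScalar_ne_zero he.mul_self, smul_eq_mul, ← mul_assoc,
    ← mul_inv, pow_two]

end IsPrimitiveQuasiIdempotent

variable {ι : Type*} [CharZero k] {e : ι → MonoidAlgebra k G}

lemma linearIndependent_centralIdem [Finite ι] (he : ∀ i, IsPrimitiveQuasiIdempotent (e i))
    (horth : Pairwise fun i j => centralIdem (e i) * centralIdem (e j) = 0) :
    LinearIndependent k fun i => centralIdem (e i) := by
  have := Fintype.ofFinite ι
  rw [Fintype.linearIndependent_iff]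
  intro t ht i
  have h := congrArg (· * centralIdem (e i)) ht
  simp only [Finset.sum_mul, smul_mul_assoc, zero_mul] at h
  rw [Finset.sum_eq_single i (fun j _ hj => by rw [horth hj, smul_zero])
    (by simp), (he i).centralIdem_mul_self] at h
  exact (smul_eq_zero.1 h).resolve_right (he i).centralIdem_ne_zero

variable [Fintype ι]

lemma span_centralIdem (he : ∀ i, IsPrimitiveQuasiIdempotent (e i))
    (horth : Pairwise fun i j => centralIdem (e i) * centralIdem (e j) = 0)
    (hcard : Nat.card (ConjClasses G) ≤ Fintype.card ι) :
    Submodule.span k (Set.range fun i => centralIdem (e i)) =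
      (Subalgebra.center k (MonoidAlgebra k G)).toSubmodule := by
  refine Submodule.eq_of_le_of_finrank_le
    (Submodule.span_le.2 (Set.range_subset_iff.2 fun i => centralIdem_mem_center (e i))) ?_
  rw [finrank_span_eq_card (linearIndependent_centralIdem he horth)]
  exact finrank_center_le_card_conjClasses.trans hcard

lemma eq_sum_smul_centralIdem (he : ∀ i, IsPrimitiveQuasiIdempotent (e i))
    (horth : Pairwise fun i j => centralIdem (e i) * centralIdem (e j) = 0)
    (hcard : Nat.card (ConjClasses G) ≤ Fintype.card ι) {x : MonoidAlgebra k G}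
    (hx : x ∈ Subalgebra.center k (MonoidAlgebra k G)) :
    x = ∑ i, (LinearMap.trace k _
        (Algebra.lsmul k k (Submodule.span (MonoidAlgebra k G) {e i}) x) /
      Module.finrank k (Submodule.span (MonoidAlgebra k G) {e i})) • centralIdem (e i) := by
  have hspan : x ∈ Submodule.span k (Set.range fun i => centralIdem (e i)) := by
    rwa [span_centralIdem he horth hcard]
  obtain ⟨t, ht⟩ := Submodule.mem_span_range_iff_exists_fun k |>.1 hspan
  have hxe (i) : x * e i = t i • e i := by
    conv_lhs => rw [← (he i).centralIdem_mul, ← mul_assoc, ← ht]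
    rw [Finset.sum_mul, Finset.sum_eq_single i
      (fun j _ hj => by rw [smul_mul_assoc, horth hj, smul_zero]) (by simp),
      smul_mul_assoc, (he i).centralIdem_mul_self, smul_mul_assoc, (he i).centralIdem_mul]
  conv_lhs => rw [← ht]
  refine Finset.sum_congr rfl fun i _ => ?_
  rw [trace_lsmul_of_mul_eq_smul hx (hxe i),
    mul_div_cancel_right₀ _ (he i).finrank_span_ne_zero]

end QuasiIdempotent

/-! ### Young symmetrizers -/

lemma apply_swap_of_eq {α β : Type*} [DecidableEq α] {f : α → β} {i j : α} (h : f i = f j)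
    (x : α) : f (Equiv.swap i j x) = f x := by
  rw [Equiv.swap_apply_def]
  split_ifs <;> simp_all

section YoungSymmetrizer

variable {d : ℕ} {lam mu : d.Partition}

/-- The row symmetrizer: the sum of the permutations preserving the rows of the reading-order
tableau. -/
def rowSym (lam : d.Partition) : GroupAlg d :=
  ∑ p : Equiv.Perm (Fin d) with ∀ i, rowOf lam (p i) = rowOf lam i, single p (1 : ℂ)

/-- The column antisymmetrizer: the signed sum of the permutations preserving the columns of the
reading-order tableau. -/
def colSym (lam : d.Partition) : GroupAlg d :=
  ∑ q : Equiv.Perm (Fin d) with ∀ i, colOf lam (q i) = colOf lam i,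
    single q (((Equiv.Perm.sign q : ℤˣ) : ℤ) : ℂ)

lemma youngSymmetrizer_eq (lam : d.Partition) :
    youngSymmetrizer lam = rowSym lam * colSym lam := rfl

lemma rowSym_mul_single {p : Equiv.Perm (Fin d)} (hp : ∀ i, rowOf lam (p i) = rowOf lam i) :
    rowSym lam * single p 1 = rowSym lam := by
  rw [rowSym, Finset.sum_mul]
  refine Finset.sum_equiv (Equiv.mulRight p) (fun g => ?_) fun g _ => by
    rw [MonoidAlgebra.single_mul_single, one_mul, Equiv.coe_mulRight]
  simp only [Finset.mem_filter_univ, Equiv.coe_mulRight, Equiv.Perm.mul_apply]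
  exact ⟨fun h i => (h _).trans (hp i), fun h i => by
    simpa using (h (p⁻¹ i)).trans (hp (p⁻¹ i)).symm⟩

lemma single_mul_colSym {q : Equiv.Perm (Fin d)} (hq : ∀ i, colOf lam (q i) = colOf lam i) :
    single q 1 * colSym lam = (((Equiv.Perm.sign q : ℤˣ) : ℤ) : ℂ) • colSym lam := by
  rw [colSym, Finset.mul_sum, Finset.smul_sum]
  refine Finset.sum_equiv (Equiv.mulLeft q) (fun g => ?_) fun g _ => ?_
  · simp only [Finset.mem_filter_univ, Equiv.coe_mulLeft, Equiv.Perm.mul_apply, hq]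
  · rw [MonoidAlgebra.single_mul_single, MonoidAlgebra.smul_single, Equiv.coe_mulLeft, map_mul,
      one_mul, smul_eq_mul, Units.val_mul, Int.cast_mul, ← mul_assoc, ← Int.cast_mul,
      ← Units.val_mul, Int.units_mul_self, Units.val_one, Int.cast_one, one_mul]

lemma single_swap_mul_colSym {i j : Fin d} (hij : i ≠ j) (h : colOf lam i = colOf lam j) :
    single (Equiv.swap i j) 1 * colSym lam = -colSym lam := by
  rw [single_mul_colSym (apply_swap_of_eq h), Equiv.Perm.sign_swap hij]
  simp

-- A transposition within a row of `lam` and a column of `g T` fixes the product and negates it.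
lemma rowSym_mul_single_mul_colSym_eq_zero {g : Equiv.Perm (Fin d)}
    (h : ¬ RowColSeparated lam mu g) : rowSym lam * single g 1 * colSym mu = 0 := by
  obtain ⟨i, j, hrowcol, hij⟩ := Function.not_injective_iff.1 h
  obtain ⟨hrow, hcol⟩ := Prod.mk.inj hrowcol
  have hneg : rowSym lam * single g 1 * colSym mu = -(rowSym lam * single g 1 * colSym mu) := by
    calc rowSym lam * single g 1 * colSym mu
        = rowSym lam * single (Equiv.swap i j * g) 1 * colSym mu := by
          conv_lhs => rw [← rowSym_mul_single (apply_swap_of_eq hrow), mul_assoc (rowSym lam),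
            MonoidAlgebra.single_mul_single, one_mul]
      _ = rowSym lam * single g 1 * (single (Equiv.swap (g⁻¹ i) (g⁻¹ j)) 1 * colSym mu) := by
          rw [Equiv.swap_mul_eq_mul_swap, ← mul_assoc, mul_assoc (rowSym lam) (single g 1),
            MonoidAlgebra.single_mul_single, one_mul]
      _ = -(rowSym lam * single g 1 * colSym mu) := by
          rw [single_swap_mul_colSym (by simpa using hij) hcol, mul_neg]
  have htwo : (2 : ℂ) • (rowSym lam * single g 1 * colSym mu) = 0 := by
    rw [two_smul]
    exact add_eq_zero_iff_eq_neg.2 hneg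
  exact (smul_eq_zero.1 htwo).resolve_left two_ne_zero

lemma rowSym_mul_mul_colSym_eq_zero (h : ∀ g, ¬ RowColSeparated lam mu g) (x : GroupAlg d) :
    rowSym lam * x * colSym mu = 0 := by
  induction x using MonoidAlgebra.induction_on with
  | of g => exact rowSym_mul_single_mul_colSym_eq_zero (h g)
  | add x y hx hy => rw [mul_add, add_mul, hx, hy, add_zero]
  | smul c x hx => rw [mul_smul_comm, smul_mul_assoc, hx, smul_zero]

lemma rowSym_mul_single_mul_colSym_mem_span (lam : d.Partition) (g : Equiv.Perm (Fin d)) :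
    rowSym lam * single g 1 * colSym lam ∈ Submodule.span ℂ {youngSymmetrizer lam} := by
  by_cases h : RowColSeparated lam lam g
  · obtain ⟨p, q, hp, hq, rfl⟩ := h.exists_eq_mul
    rw [← one_mul (1 : ℂ), ← MonoidAlgebra.single_mul_single, ← mul_assoc, rowSym_mul_single hp,
      mul_assoc, single_mul_colSym hq, mul_smul_comm, ← youngSymmetrizer_eq]
    exact Submodule.smul_mem _ _ (Submodule.mem_span_singleton_self _)
  · rw [rowSym_mul_single_mul_colSym_eq_zero h]
    exact zero_mem _

lemma rowSym_mul_mul_colSym_mem_span (lam : d.Partition) (x : GroupAlg d) :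
    rowSym lam * x * colSym lam ∈ Submodule.span ℂ {youngSymmetrizer lam} := by
  induction x using MonoidAlgebra.induction_on with
  | of g => exact rowSym_mul_single_mul_colSym_mem_span lam g
  | add x y hx hy => rw [mul_add, add_mul]; exact add_mem hx hy
  | smul c x hx => rw [mul_smul_comm, smul_mul_assoc]; exact Submodule.smul_mem _ c hx

-- Only `p = q = 1` contributes: a permutation preserving rows and columns is the identity.
lemma coeff_one_youngSymmetrizer (lam : d.Partition) : (youngSymmetrizer lam).coeff 1 = 1 := by
  have hcol {p : Equiv.Perm (Fin d)} : (colSym lam).coeff p⁻¹ =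
      if ∀ i, colOf lam (p i) = colOf lam i then (((Equiv.Perm.sign p : ℤˣ) : ℤ) : ℂ) else 0 := by
    have hinv : (∀ i, colOf lam (p⁻¹ i) = colOf lam i) ↔ ∀ i, colOf lam (p i) = colOf lam i :=
      ⟨fun h i => by simpa using (h (p i)).symm, fun h i => by simpa using (h (p⁻¹ i)).symm⟩
    rw [colSym, MonoidAlgebra.coeff_sum, Finset.sum_apply']
    simp only [MonoidAlgebra.coeff_single, Finsupp.single_apply, Finset.sum_ite_eq',
      Finset.mem_filter_univ, hinv, Equiv.Perm.sign_inv]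
  rw [youngSymmetrizer_eq, rowSym, Finset.sum_mul, MonoidAlgebra.coeff_sum, Finset.sum_apply',
    Finset.sum_eq_single_of_mem 1 (by simp)]
  · rw [MonoidAlgebra.coeff_single_mul_apply, mul_one, hcol]
    simp
  · intro p hp hp1
    rw [MonoidAlgebra.coeff_single_mul_apply, mul_one, one_mul, hcol, if_neg]
    exact fun hq => hp1 (Equiv.ext fun i => injective_rowOf_colOf lam
      (Prod.ext ((Finset.mem_filter_univ p).1 hp i) (hq i)))

lemma isPrimitiveQuasiIdempotent_youngSymmetrizer (lam : d.Partition) :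
    IsPrimitiveQuasiIdempotent (youngSymmetrizer lam) where
  coeff_one := coeff_one_youngSymmetrizer lam
  exists_mul_mul_eq_smul x := by
    obtain ⟨t, ht⟩ := Submodule.mem_span_singleton.1
      (rowSym_mul_mul_colSym_mem_span lam (colSym lam * x * rowSym lam))
    exact ⟨t, by rw [ht]; simp only [youngSymmetrizer_eq, mul_assoc]⟩

lemma quasiScalar_youngSymmetrizer_ne_zero (lam : d.Partition) :
    quasiScalar (youngSymmetrizer lam) ≠ 0 :=
  (isPrimitiveQuasiIdempotent_youngSymmetrizer lam).quasiScalar_ne_zero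

lemma quasiScalar_youngSymmetrizer_mul_dimV (lam : d.Partition) :
    quasiScalar (youngSymmetrizer lam) * dimV lam = d.factorial := by
  simpa only [Fintype.card_perm, Fintype.card_fin, dimV] using
    (isPrimitiveQuasiIdempotent_youngSymmetrizer lam).quasiScalar_mul_finrank

lemma dimV_ne_zero (lam : d.Partition) : (dimV lam : ℂ) ≠ 0 :=
  (isPrimitiveQuasiIdempotent_youngSymmetrizer lam).finrank_span_ne_zero

lemma youngSymmetrizer_mul_mul_eq_zero (h : ∀ g, ¬ RowColSeparated lam mu g) (x : GroupAlg d) :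
    youngSymmetrizer lam * x * youngSymmetrizer mu = 0 := by
  rw [← rowSym_mul_mul_colSym_eq_zero h (colSym lam * x * rowSym mu)]
  simp only [youngSymmetrizer_eq, mul_assoc]

/-- The primitive central idempotent of the group algebra of `S(d)` attached to `lam`. -/
abbrev youngCentralIdem (lam : d.Partition) : GroupAlg d := centralIdem (youngSymmetrizer lam)

lemma youngCentralIdem_mul_self (lam : d.Partition) :
    youngCentralIdem lam * youngCentralIdem lam = youngCentralIdem lam :=
  (isPrimitiveQuasiIdempotent_youngSymmetrizer lam).centralIdem_mul_self

lemma youngCentralIdem_mul_of_ne (h : lam ≠ mu) :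
    youngCentralIdem lam * youngCentralIdem mu = 0 := by
  by_cases hsep : ∃ g, RowColSeparated lam mu g
  · obtain ⟨g, hg⟩ := hsep
    rw [Subalgebra.mem_center_iff.1 (centralIdem_mem_center _)]
    exact centralIdem_mul_eq_zero
      (youngSymmetrizer_mul_mul_eq_zero fun g' hg' => h (hg.eq_of_symm hg'))
  · exact centralIdem_mul_eq_zero (youngSymmetrizer_mul_mul_eq_zero (not_exists.1 hsep))

end YoungSymmetrizer

/-! ### Class sums -/

section ClassSum

variable {d : ℕ} {α : d.Partition} {σ τ : Equiv.Perm (Fin d)}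

/-- The cycle type of a permutation of `Fin d`, with fixed points included, as a partition of `d`
(for `Equiv.Perm.partition` it is a partition of `Fintype.card (Fin d)`). -/
def cyclePartition (σ : Equiv.Perm (Fin d)) : d.Partition where
  parts := σ.partition.parts
  parts_pos := σ.partition.parts_pos
  parts_sum := σ.partition.parts_sum.trans (Fintype.card_fin d)

lemma mem_conjClass : σ ∈ conjClass α ↔ cyclePartition σ = α := by
  rw [conjClass, Finset.mem_filter_univ, Nat.Partition.ext_iff, cyclePartition]

lemma isConj_iff_cyclePartition_eq : IsConj σ τ ↔ cyclePartition σ = cyclePartition τ := by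
  rw [Equiv.Perm.partition_eq_of_isConj, Nat.Partition.ext_iff, Nat.Partition.ext_iff,
    cyclePartition, cyclePartition]

lemma inv_mem_conjClass : σ⁻¹ ∈ conjClass α ↔ σ ∈ conjClass α := by
  rw [mem_conjClass, mem_conjClass, isConj_iff_cyclePartition_eq.1
    (Equiv.Perm.isConj_iff_cycleType_eq.2 σ.cycleType_inv)]

lemma sum_perm_eq_sum_conjClass {M : Type*} [AddCommMonoid M] (f : Equiv.Perm (Fin d) → M) :
    ∑ σ, f σ = ∑ α : d.Partition, ∑ σ ∈ conjClass α, f σ := by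
  rw [← Finset.sum_fiberwise Finset.univ cyclePartition f]
  refine Finset.sum_congr rfl fun α _ => Finset.sum_congr ?_ fun _ _ => rfl
  ext σ
  rw [Finset.mem_filter_univ, mem_conjClass]

lemma card_conjClasses_perm_le (d : ℕ) :
    Nat.card (ConjClasses (Equiv.Perm (Fin d))) ≤ Fintype.card d.Partition := by
  rw [← Nat.card_eq_fintype_card]
  refine Nat.card_le_card_of_injective
    (Quotient.lift cyclePartition fun _ _ h => isConj_iff_cyclePartition_eq.1 h) ?_
  rintro ⟨σ⟩ ⟨τ⟩ h
  exact Quotient.sound (isConj_iff_cyclePartition_eq.2 h)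

/-- The sum of the permutations of cycle type `α`, a central element of the group algebra. -/
def classSum (α : d.Partition) : GroupAlg d := ∑ σ ∈ conjClass α, single σ (1 : ℂ)

lemma classSum_mem_center (α : d.Partition) : classSum α ∈ Subalgebra.center ℂ (GroupAlg d) :=
  sum_single_mem_center fun g _ hσ => mem_conjClass.2 <| (mem_conjClass.1 hσ) ▸
    (isConj_iff_cyclePartition_eq.1 (isConj_iff.2 ⟨g, rfl⟩)).symm

lemma eq_sum_smul_youngCentralIdem {x : GroupAlg d} (hx : x ∈ Subalgebra.center ℂ (GroupAlg d)) :
    x = ∑ lam : d.Partition,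
      (LinearMap.trace ℂ (irrepV lam) (Algebra.lsmul ℂ ℂ (irrepV lam) x) / dimV lam) •
        youngCentralIdem lam :=
  eq_sum_smul_centralIdem isPrimitiveQuasiIdempotent_youngSymmetrizer
    (fun _ _ => youngCentralIdem_mul_of_ne) (card_conjClasses_perm_le d) hx

lemma sum_youngCentralIdem (d : ℕ) : ∑ lam : d.Partition, youngCentralIdem lam = 1 := by
  conv_rhs => rw [eq_sum_smul_youngCentralIdem (one_mem (Subalgebra.center ℂ (GroupAlg d)))]
  refine Finset.sum_congr rfl fun lam _ => ?_
  rw [map_one, LinearMap.trace_one, ← dimV, div_self (dimV_ne_zero lam), one_smul]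

lemma classSum_eq (α : d.Partition) :
    classSum α = ∑ lam, omega α lam • youngCentralIdem lam := by
  conv_lhs => rw [eq_sum_smul_youngCentralIdem (classSum_mem_center α)]
  simp only [classSum, map_sum, omega, character, MonoidAlgebra.of_apply]

lemma coeff_youngCentralIdem (lam : d.Partition) (σ : Equiv.Perm (Fin d)) :
    (youngCentralIdem lam).coeff σ =
      (quasiScalar (youngSymmetrizer lam))⁻¹ * character lam σ⁻¹ :=
  (isPrimitiveQuasiIdempotent_youngSymmetrizer lam).coeff_centralIdem σ

lemma sum_conjClass_coeff_youngCentralIdem (α lam : d.Partition) :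
    ∑ σ ∈ conjClass α, (youngCentralIdem lam).coeff σ =
      (dimV lam : ℂ) ^ 2 / d.factorial * omega α lam := by
  simp only [coeff_youngCentralIdem]
  rw [← Finset.mul_sum, Finset.sum_equiv (Equiv.inv _) (t := conjClass α)
    (f := fun σ => character lam σ⁻¹) (g := character lam) (fun _ => inv_mem_conjClass.symm)
    (fun _ _ => rfl),
    omega, ← quasiScalar_youngSymmetrizer_mul_dimV lam]
  field_simp [quasiScalar_youngSymmetrizer_ne_zero lam, dimV_ne_zero lam]

end ClassSum

/-! ### Tensor space in coordinates -/

section TensorPow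

variable {ι n R : Type*} [Fintype ι] [CommSemiring R]

/-- The matrix, in the standard basis, of the tensor power `A^{⊗ ι}`. -/
def tensorPow (ι : Type*) [Fintype ι] {n R : Type*} [CommSemiring R] (A : Matrix n n R) :
    Matrix (ι → n) (ι → n) R :=
  Matrix.of fun i j => ∏ r, A (i r) (j r)

lemma tensorPow_apply (A : Matrix n n R) (i j : ι → n) :
    tensorPow ι A i j = ∏ r, A (i r) (j r) := rfl

lemma tensorPow_diagonal [DecidableEq n] (x : n → R) :
    tensorPow ι (Matrix.diagonal x) = Matrix.diagonal fun i => ∏ r, x (i r) := by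
  ext i j
  simp only [tensorPow_apply, Matrix.diagonal_apply, Fintype.prod_ite_zero, funext_iff]

lemma tensorPow_one [DecidableEq n] : tensorPow ι (1 : Matrix n n R) = 1 := by
  rw [← Matrix.diagonal_one, tensorPow_diagonal]
  simp only [Finset.prod_const_one, Matrix.diagonal_one]

variable [Fintype n] [DecidableEq ι]

lemma tensorPow_mul (A B : Matrix n n R) : tensorPow ι (A * B) = tensorPow ι A * tensorPow ι B := by
  ext i j
  simp only [tensorPow_apply, Matrix.mul_apply, ← Finset.prod_mul_distrib]
  rw [Finset.prod_univ_sum, Fintype.piFinset_univ]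

lemma trace_tensorPow (A : Matrix n n R) :
    (tensorPow ι A).trace = A.trace ^ Fintype.card ι := by
  simp only [Matrix.trace, Matrix.diag_apply, tensorPow_apply]
  rw [← Fintype.piFinset_univ, ← Finset.prod_univ_sum (f := fun _ k => A k k), Finset.prod_const,
    Finset.card_univ]

variable [DecidableEq n]

variable (n R) in
/-- The matrices, in the standard basis of a tensor power, of the permutations of the tensor
factors. -/
def permMat : Equiv.Perm ι →* Matrix (ι → n) (ι → n) R where
  toFun σ := Matrix.of fun i j => if i ∘ σ = j then 1 else 0
  map_one' := by
    ext i j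
    simp [Matrix.one_apply]
  map_mul' σ τ := by
    ext i j
    simp only [Matrix.of_apply, Matrix.mul_apply, ite_mul, one_mul, zero_mul, Finset.sum_ite_eq,
      Finset.mem_univ, if_true]
    rfl

lemma permMat_apply (σ : Equiv.Perm ι) (i j : ι → n) :
    permMat n R σ i j = if i ∘ σ = j then 1 else 0 := rfl

lemma permMat_mul_apply (σ : Equiv.Perm ι) (X : Matrix (ι → n) (ι → n) R) (i j : ι → n) :
    (permMat n R σ * X) i j = X (i ∘ σ) j := by
  simp [Matrix.mul_apply, permMat_apply]

lemma mul_permMat_apply (σ : Equiv.Perm ι) (X : Matrix (ι → n) (ι → n) R) (i j : ι → n) :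
    (X * permMat n R σ) i j = X i (j ∘ σ.symm) := by
  simp [Matrix.mul_apply, permMat_apply, ← Equiv.eq_comp_symm]

lemma commute_permMat_iff (σ : Equiv.Perm ι) (X : Matrix (ι → n) (ι → n) R) :
    Commute (permMat n R σ) X ↔ ∀ i j, X (i ∘ σ) (j ∘ σ) = X i j := by
  rw [commute_iff_eq, ← Matrix.ext_iff]
  simp only [permMat_mul_apply, mul_permMat_apply]
  exact forall_congr' fun i => (σ.arrowCongr (Equiv.refl n)).forall_congr fun {j} => by
    simp [Equiv.arrowCongr, Function.comp_assoc]

lemma commute_permMat_tensorPow (σ : Equiv.Perm ι) (A : Matrix n n R) :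
    Commute (permMat n R σ) (tensorPow ι A) :=
  (commute_permMat_iff σ _).2 fun i j => Equiv.prod_comp σ fun r => A (i r) (j r)

lemma trace_tensorPow_mul_permMat (A : Matrix n n R) (σ : Equiv.Perm ι) :
    (tensorPow ι A * permMat n R σ).trace = ∑ i : ι → n, ∏ r, A (i (σ r)) (i r) := by
  rw [← (commute_permMat_tensorPow σ A).eq]
  simp only [Matrix.trace, Matrix.diag_apply, permMat_mul_apply, tensorPow_apply,
    Function.comp_apply]

variable (n) in
/-- The action of the group algebra on a tensor power by permutation of the tensor factors, in
coordinates. -/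
def tensorRep : MonoidAlgebra R (Equiv.Perm ι) →ₐ[R] Matrix (ι → n) (ι → n) R :=
  MonoidAlgebra.lift R _ _ (permMat n R)

lemma tensorRep_single (σ : Equiv.Perm ι) (c : R) :
    tensorRep n (single σ c) = c • permMat n R σ :=
  MonoidAlgebra.lift_single ..

lemma tensorRep_eq_sum (x : MonoidAlgebra R (Equiv.Perm ι)) :
    tensorRep n x = ∑ σ, x.coeff σ • permMat n R σ := by
  conv_lhs => rw [← sum_coeff_smul_single x]
  simp only [map_sum, map_smul, tensorRep_single, one_smul]

lemma commute_tensorRep {Z : Matrix (ι → n) (ι → n) R} (h : ∀ σ, Commute (permMat n R σ) Z)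
    (x : MonoidAlgebra R (Equiv.Perm ι)) : Commute (tensorRep n x) Z := by
  rw [tensorRep_eq_sum]
  exact Commute.sum_left _ _ _ fun σ _ => (h σ).smul_left _

end TensorPow

section IrrepW

variable {N d : ℕ} {lam : d.Partition}

/-- The standard basis of tensor space. -/
def tensorBasis (N d : ℕ) : Module.Basis (Fin d → Fin N) ℂ (TensorSpace N d) :=
  Basis.piTensorProduct fun _ => Pi.basisFun ℂ (Fin N)

/-- The action of the group algebra on tensor space; `irrepW` is the range of the Young symmetrizer
in this action. -/
abbrev tensorAction (N d : ℕ) : GroupAlg d →ₐ[ℂ] Module.End ℂ (TensorSpace N d) :=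
  MonoidAlgebra.lift ℂ (Module.End ℂ (TensorSpace N d)) (Equiv.Perm (Fin d)) (permTensor N d)

lemma toMatrix_permTensor (σ : Equiv.Perm (Fin d)) :
    LinearMap.toMatrix (tensorBasis N d) (tensorBasis N d) (permTensor N d σ) =
      permMat (Fin N) ℂ σ := by
  ext i j
  have h : permTensor N d σ (tensorBasis N d j) = tensorBasis N d (j ∘ σ.symm) := by
    simp only [tensorBasis, Basis.piTensorProduct_apply]
    exact PiTensorProduct.reindex_tprod _ _
  rw [LinearMap.toMatrix_apply, h, Module.Basis.repr_self, permMat_apply, Finsupp.single_apply]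
  exact if_congr (by rw [eq_comm, Equiv.eq_comp_symm]) rfl rfl

lemma toMatrix_tensorAction (x : GroupAlg d) :
    LinearMap.toMatrix (tensorBasis N d) (tensorBasis N d) (tensorAction N d x) =
      tensorRep (Fin N) x := by
  conv_lhs => rw [← sum_coeff_smul_single x]
  simp only [tensorRep_eq_sum, map_sum, map_smul, MonoidAlgebra.lift_single, one_smul,
    toMatrix_permTensor]

lemma quasiScalar_youngSymmetrizer_mul_dimW (N : ℕ) (lam : d.Partition) :
    quasiScalar (youngSymmetrizer lam) * dimW N lam =
      (tensorRep (Fin N) (youngSymmetrizer lam)).trace := by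
  have hsq : tensorAction N d (youngSymmetrizer lam) * tensorAction N d (youngSymmetrizer lam) =
      quasiScalar (youngSymmetrizer lam) • tensorAction N d (youngSymmetrizer lam) := by
    rw [← map_mul, (isPrimitiveQuasiIdempotent_youngSymmetrizer lam).mul_self, map_smul]
  rw [dimW, ← trace_eq_mul_finrank_range (quasiScalar_youngSymmetrizer_ne_zero lam) hsq,
    LinearMap.trace_eq_matrix_trace ℂ (tensorBasis N d), toMatrix_tensorAction]

lemma trace_tensorRep_youngCentralIdem (N : ℕ) (lam : d.Partition) :
    (tensorRep (Fin N) (youngCentralIdem lam)).trace = dimV lam * dimW N lam := by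
  have hτ := map_conjSum_of_trace
    (τ := Matrix.traceLinearMap _ ℂ ℂ ∘ₗ (tensorRep (ι := Fin d) (R := ℂ) (Fin N)).toLinearMap)
    (fun x y => by
      simpa only [LinearMap.comp_apply, AlgHom.toLinearMap_apply, Matrix.traceLinearMap_apply,
        map_mul] using Matrix.trace_mul_comm _ _)
    (youngSymmetrizer lam)
  simp only [LinearMap.comp_apply, AlgHom.toLinearMap_apply, Matrix.traceLinearMap_apply,
    Fintype.card_perm, Fintype.card_fin] at hτ
  rw [youngCentralIdem, centralIdem, map_smul, Matrix.trace_smul, hτ,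
    ← quasiScalar_youngSymmetrizer_mul_dimW, nsmul_eq_mul,
    ← quasiScalar_youngSymmetrizer_mul_dimV lam, smul_eq_mul]
  field_simp [quasiScalar_youngSymmetrizer_ne_zero lam]

lemma tensorRep_youngCentralIdem_eq_zero (h : dimW N lam = 0) :
    tensorRep (Fin N) (youngCentralIdem lam) = 0 := by
  have hsym : tensorRep (Fin N) (youngSymmetrizer lam) = 0 := by
    rw [dimW, Submodule.finrank_eq_zero, LinearMap.range_eq_bot] at h
    rw [← toMatrix_tensorAction, h, map_zero]
  rw [youngCentralIdem, centralIdem, conjSum, map_smul, map_sum]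
  simp only [map_mul, hsym, mul_zero, zero_mul, Finset.sum_const_zero, smul_zero]

-- By the pigeonhole principle two cells of the first column carry the same basis vector.
lemma tensorRep_colSym_eq_zero (h : N < lam.parts.card) : tensorRep (Fin N) (colSym lam) = 0 := by
  ext i j
  obtain ⟨x, hx, y, hy, hxy, hi⟩ := Finset.exists_ne_map_eq_of_card_lt_of_maps_to
    (s := {x | colOf lam x = 0}) (t := Finset.univ) (f := i)
    (by rwa [Finset.card_univ, Fintype.card_fin, ← colLength, ← card_parts_eq_colLength_zero])
    (fun _ _ => Finset.mem_coe.2 (Finset.mem_univ _))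
  rw [Finset.mem_filter_univ] at hx hy
  have hneg := congrArg (fun c => tensorRep (Fin N) c i j)
    (single_swap_mul_colSym hxy (hx.trans hy.symm))
  simp only [map_mul, map_neg, tensorRep_single, one_smul, permMat_mul_apply, Matrix.neg_apply,
    show i ∘ Equiv.swap x y = i from funext (apply_swap_of_eq hi)] at hneg
  exact self_eq_neg.1 hneg

lemma dimW_eq_zero (h : N < lam.parts.card) : dimW N lam = 0 := by
  have hmul := quasiScalar_youngSymmetrizer_mul_dimW N lam
  rw [youngSymmetrizer_eq, map_mul, tensorRep_colSym_eq_zero h, mul_zero, Matrix.trace_zero,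
    ← youngSymmetrizer_eq] at hmul
  exact_mod_cast (mul_eq_zero.1 hmul).resolve_left (quasiScalar_youngSymmetrizer_ne_zero lam)

end IrrepW

/-! ### Schur–Weyl duality -/

section DoubleCommutant

variable {k G V : Type*} [CommRing k] [Monoid G] [AddCommGroup V] [Module k V] [Module.Finite k V]

lemma exists_asAlgebraHom_eq_of_commute (ρ : Representation k G V)
    [IsSemisimpleModule (MonoidAlgebra k G) ρ.asModule] {f : Module.End k V}
    (hf : ∀ h : Module.End k V, (∀ g, Commute (ρ g) h) → Commute f h) :
    ∃ x, ρ.asAlgebraHom x = f := by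
  have hsmul (φ : Module.End (MonoidAlgebra k G) ρ.asModule) (m : ρ.asModule) :
      f (φ m) = φ (f m) := by
    let h : Module.End k V := φ.restrictScalars k
    refine congr($(hf h fun g => LinearMap.ext fun v => ?_) m)
    have hφ := φ.map_smul (single g 1) (ρ.asModuleEquiv.symm v)
    rw [Representation.single_smul, Representation.single_smul, one_smul, one_smul] at hφ
    exact hφ.symm
  let f' : Module.End (Module.End (MonoidAlgebra k G) ρ.asModule) ρ.asModule :=
    { toFun := f
      map_add' := f.map_add
      map_smul' := hsmul }
  obtain ⟨s, hs⟩ := Module.Finite.fg_top (R := k) (M := V)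
  obtain ⟨x, hx⟩ := jacobson_density f' s
  exact ⟨x, LinearMap.ext_on hs fun m hm => (hx m hm).symm⟩

end DoubleCommutant

section Commutant

variable {ι n κ R K : Type*} [Fintype ι]

lemma exists_perm_comp_eq [DecidableEq κ] {u v : ι → κ}
    (h : ∀ a, #{r | u r = a} = #{r | v r = a}) : ∃ σ : Equiv.Perm ι, v ∘ σ = u := by
  have e (a : κ) : Nonempty ({r // u r = a} ≃ {r // v r = a}) :=
    ⟨Fintype.equivOfCardEq (by rw [Fintype.card_subtype, Fintype.card_subtype, h])⟩
  exact ⟨Equiv.ofFiberEquiv fun a => (e a).some, funext fun r => Equiv.ofFiberEquiv_map _ r⟩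

lemma prod_X_eq_monomial [CommSemiring R] (u : ι → κ) :
    ∏ r, (MvPolynomial.X (u r) : MvPolynomial κ R) =
      MvPolynomial.monomial (∑ r, Finsupp.single (u r) 1) 1 :=
  (MvPolynomial.monomial_sum_one _ _).symm

lemma exists_functional_prod_X [CommSemiring R] {f : (ι → κ) → R}
    (hf : ∀ u (σ : Equiv.Perm ι), f (u ∘ σ) = f u) :
    ∃ φ : MvPolynomial κ R →ₗ[R] R, ∀ u, φ (∏ r, MvPolynomial.X (u r)) = f u := by
  classical
  let exponent (u : ι → κ) : κ →₀ ℕ := ∑ r, Finsupp.single (u r) 1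
  have hfac {u v : ι → κ} (huv : exponent u = exponent v) : f u = f v := by
    obtain ⟨σ, rfl⟩ := exists_perm_comp_eq (u := u) (v := v) fun a => by
      simpa [exponent, Finsupp.single_apply] using DFunLike.congr_fun huv a
    exact hf v σ
  refine ⟨(MvPolynomial.basisMonomials κ R).constr R (Function.extend exponent f 0), fun u => ?_⟩
  have hext : Function.FactorsThrough f exponent := fun _ _ => hfac
  rw [prod_X_eq_monomial, ← hext.extend_apply 0 u, ← congrFun (MvPolynomial.coe_basisMonomials κ R),
    Module.Basis.constr_basis]

variable [DecidableEq ι] [Fintype n] [DecidableEq n]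

lemma exists_tensorRep_eq_of_commute [Field K] [NeZero (Nat.card (Equiv.Perm ι) : K)]
    {Y : Matrix (ι → n) (ι → n) K}
    (hY : ∀ Z, (∀ σ, Commute (permMat n K σ) Z) → Commute Y Z) : ∃ x, tensorRep n x = Y := by
  let e : Matrix (ι → n) (ι → n) K ≃ₐ[K] Module.End K ((ι → n) → K) := Matrix.toLinAlgEquiv'
  let ρ : Representation K (Equiv.Perm ι) ((ι → n) → K) := (e : _ →* _).comp (permMat n K)
  have hρ (σ : Equiv.Perm ι) : ρ σ = e (permMat n K σ) := rfl
  obtain ⟨x, hx⟩ := exists_asAlgebraHom_eq_of_commute ρ (f := e Y) fun h hh => by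
    rw [← e.apply_symm_apply h]
    refine (hY _ fun σ => ?_).map e
    simpa [hρ] using (hh σ).map e.symm
  refine ⟨x, e.injective ?_⟩
  rw [← hx, tensorRep_eq_sum, Representation.asAlgebraHom_def, MonoidAlgebra.lift_apply]
  simp [hρ, Finsupp.sum_fintype]

-- Both sides pair the entries of `Z`, as a functional on polynomials in the entries of `g`, with
-- the two sides of `Y g^{⊗ ι} = g^{⊗ ι} Y`.
lemma commute_of_commute_gl [Field K] [Infinite K] {Y Z : Matrix (ι → n) (ι → n) K}
    (hY : ∀ g : GL n K, Commute Y (tensorPow ι (g : Matrix n n K)))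
    (hZ : ∀ σ, Commute (permMat n K σ) Z) : Commute Y Z := by
  obtain ⟨φ, hφ⟩ := exists_functional_prod_X
    (f := fun u : ι → n × n => Z (Prod.fst ∘ u) (Prod.snd ∘ u)) fun u σ =>
      (commute_permMat_iff σ Z).1 (hZ σ) (Prod.fst ∘ u) (Prod.snd ∘ u)
  have hφZ (i j : ι → n) : φ (∏ r, MvPolynomial.X (i r, j r)) = Z i j :=
    hφ fun r => (i r, j r)
  ext i k
  have hPQ : ∑ j, Y i j • ∏ r, MvPolynomial.X (j r, k r) =
      ∑ j, Y j k • ∏ r, (MvPolynomial.X (i r, j r) : MvPolynomial (n × n) K) :=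
    MvPolynomial.eq_of_eval_eq_on_gl fun g => by
      simpa only [map_sum, MvPolynomial.smul_eval, map_prod, MvPolynomial.eval_X, Matrix.mul_apply,
        tensorPow_apply, mul_comm (Y _ k)] using congr($(hY g) i k)
  have h := congrArg φ hPQ
  simpa only [map_sum, map_smul, hφZ, smul_eq_mul, mul_comm (Y _ k), Matrix.mul_apply] using h

end Commutant

section Unitary

variable {𝕜 ι n : Type*} [RCLike 𝕜] [Fintype ι] [DecidableEq ι] [Fintype n] [DecidableEq n]

lemma diagonal_mem_unitaryGroup {x : n → 𝕜} (hx : ∀ i, ‖x i‖ = 1) :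
    Matrix.diagonal x ∈ Matrix.unitaryGroup n 𝕜 := by
  rw [Matrix.mem_unitaryGroup_iff, Matrix.star_eq_conjTranspose, Matrix.diagonal_conjTranspose,
    Matrix.diagonal_mul_diagonal, ← Matrix.diagonal_one]
  congr 1
  ext1 i
  rw [Pi.star_apply, RCLike.star_def, RCLike.mul_conj, hx, RCLike.ofReal_one, one_pow]

lemma exists_eq_unitary_mul_diagonal {B : Matrix n n 𝕜} {y : n → ℝ} (hy : ∀ i, 0 < y i)
    (hB : B.conjTranspose * B = Matrix.diagonal fun i => (y i : 𝕜)) :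
    ∃ W ∈ Matrix.unitaryGroup n 𝕜, B = W * Matrix.diagonal fun i => ((√(y i) : ℝ) : 𝕜) := by
  have hs (i : n) : √(y i) ≠ 0 := (Real.sqrt_pos.2 (hy i)).ne'
  refine ⟨B * Matrix.diagonal fun i => (((√(y i))⁻¹ : ℝ) : 𝕜), ?_, ?_⟩
  · rw [Matrix.mem_unitaryGroup_iff', Matrix.star_eq_conjTranspose, Matrix.conjTranspose_mul,
      mul_assoc, ← mul_assoc B.conjTranspose, hB, Matrix.diagonal_conjTranspose,
      Matrix.diagonal_mul_diagonal, Matrix.diagonal_mul_diagonal, ← Matrix.diagonal_one]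
    congr 1
    ext1 i
    rw [Pi.star_apply, RCLike.star_def, RCLike.conj_ofReal, ← RCLike.ofReal_mul,
      ← RCLike.ofReal_mul, ← RCLike.ofReal_one]
    congr 1
    nth_rewrite 2 [← Real.mul_self_sqrt (hy i).le]
    field_simp [hs i]
  · rw [mul_assoc, Matrix.diagonal_mul_diagonal]
    simp only [← RCLike.ofReal_mul, inv_mul_cancel₀ (hs _), RCLike.ofReal_one, Matrix.diagonal_one,
      mul_one]

open scoped ComplexOrder in
lemma exists_singular_value_decomposition (A : GL n 𝕜) :
    ∃ (W V : Matrix.unitaryGroup n 𝕜) (s : n → 𝕜),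
      (A : Matrix n n 𝕜) = (W : Matrix n n 𝕜) * Matrix.diagonal s * (V : Matrix n n 𝕜) := by
  have hpos : ((A : Matrix n n 𝕜).conjTranspose * A).PosDef :=
    Matrix.PosDef.conjTranspose_mul_self _ (Matrix.mulVec_injective_iff_isUnit.2 A.isUnit)
  let V := hpos.1.eigenvectorUnitary
  obtain ⟨W, hW, hAV⟩ := exists_eq_unitary_mul_diagonal (B := (A : Matrix n n 𝕜) * V.1)
    hpos.eigenvalues_pos (by
      have hspec := Matrix.IsHermitian.conjStarAlgAut_star_eigenvectorUnitary hpos.1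
      rw [Unitary.conjStarAlgAut_star_apply] at hspec
      rw [Matrix.conjTranspose_mul, ← mul_assoc, mul_assoc _ _ (A : Matrix n n 𝕜)]
      exact hspec)
  refine ⟨⟨W, hW⟩, V⁻¹, fun i => ((√(Matrix.IsHermitian.eigenvalues hpos.1 i) : ℝ) : 𝕜), ?_⟩
  rw [← hAV, mul_assoc, ← Matrix.UnitaryGroup.mul_val, mul_inv_cancel, Matrix.UnitaryGroup.one_val,
    mul_one]

variable {Y : Matrix (ι → n) (ι → n) ℂ}

lemma exists_perm_comp_eq_of_commute_unitary
    (hY : ∀ U : Matrix.unitaryGroup n ℂ, Commute Y (tensorPow ι (U : Matrix n n ℂ)))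
    {i j : ι → n} (hij : Y i j ≠ 0) : ∃ σ : Equiv.Perm ι, j ∘ σ = i := by
  refine exists_perm_comp_eq fun k => ?_
  have hζ := Complex.isPrimitiveRoot_exp (Fintype.card ι + 1) (Nat.succ_ne_zero _)
  set ζ := Complex.exp (2 * Real.pi * Complex.I / (Fintype.card ι + 1 : ℕ))
  have hnorm (l : n) : ‖if l = k then ζ else 1‖ = 1 := by
    split_ifs
    exacts [hζ.norm'_eq_one (Nat.succ_ne_zero _), norm_one]
  have hcomm := congr($(hY ⟨_, diagonal_mem_unitaryGroup hnorm⟩) i j)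
  rw [tensorPow_diagonal, Matrix.mul_diagonal, Matrix.diagonal_mul, mul_comm] at hcomm
  have hpow := mul_right_cancel₀ hij hcomm
  simp only [Finset.prod_ite, Finset.prod_const, one_pow, mul_one] at hpow
  exact (hζ.pow_inj (Nat.lt_succ_of_le (Finset.card_le_univ _))
    (Nat.lt_succ_of_le (Finset.card_le_univ _)) hpow).symm

lemma commute_diagonal_of_commute_unitary
    (hY : ∀ U : Matrix.unitaryGroup n ℂ, Commute Y (tensorPow ι (U : Matrix n n ℂ))) (x : n → ℂ) :
    Commute Y (tensorPow ι (Matrix.diagonal x)) := by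
  ext i j
  rw [tensorPow_diagonal, Matrix.mul_diagonal, Matrix.diagonal_mul]
  by_cases hij : Y i j = 0
  · rw [hij, zero_mul, mul_zero]
  · obtain ⟨σ, rfl⟩ := exists_perm_comp_eq_of_commute_unitary hY hij
    rw [mul_comm, ← Equiv.prod_comp σ fun r => x (j r)]
    rfl

lemma commute_gl_of_commute_unitary
    (hY : ∀ U : Matrix.unitaryGroup n ℂ, Commute Y (tensorPow ι (U : Matrix n n ℂ))) (g : GL n ℂ) :
    Commute Y (tensorPow ι (g : Matrix n n ℂ)) := by
  obtain ⟨W, V, x, hg⟩ := exists_singular_value_decomposition g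
  rw [hg, tensorPow_mul, tensorPow_mul]
  exact ((hY W).mul_right (commute_diagonal_of_commute_unitary hY x)).mul_right (hY V)

/-- **Schur–Weyl duality** for the unitary group. -/
theorem exists_tensorRep_eq_of_commute_unitary
    (hY : ∀ U : Matrix.unitaryGroup n ℂ, Commute Y (tensorPow ι (U : Matrix n n ℂ))) :
    ∃ x, tensorRep n x = Y :=
  exists_tensorRep_eq_of_commute fun _ hZ =>
    commute_of_commute_gl (commute_gl_of_commute_unitary hY) hZ

end Unitary

/-! ### Power sums as traces on tensor space -/

section CycleProducts

open Equiv.Perm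

variable {ι M : Type*} [Fintype ι] [DecidableEq ι] [CommMonoid M] (σ : Equiv.Perm ι)

open scoped Classical in
lemma filter_mk_eq_of_mem_support {x : ι} (hx : x ∈ σ.support) :
    ({r | Quotient.mk (SameCycle.setoid σ) r = Quotient.mk _ x} : Finset ι) =
      (σ.cycleOf x).support := by
  ext r
  rw [Finset.mem_filter_univ, Quotient.eq, mem_support_cycleOf_iff, and_iff_left hx]
  exact sameCycle_comm

open scoped Classical in
lemma filter_mk_eq_of_notMem_support {x : ι} (hx : x ∉ σ.support) :
    ({r | Quotient.mk (SameCycle.setoid σ) r = Quotient.mk _ x} : Finset ι) = {x} := by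
  ext r
  rw [Finset.mem_filter_univ, Quotient.eq, Finset.mem_singleton]
  exact ⟨fun h => (h.symm.eq_of_left (notMem_support.1 hx)).symm, fun h => h ▸ SameCycle.refl _ _⟩

open scoped Classical in
lemma prod_moved_cycles (g : ℕ → M) :
    ∏ q : Quotient (SameCycle.setoid σ) with ∃ x ∈ σ.support, Quotient.mk _ x = q,
      g #{r | Quotient.mk _ r = q} = (σ.cycleType.map g).prod := by
  rw [cycleType_def, Multiset.map_map]
  refine Finset.prod_nbij (t := σ.cycleFactorsFinset) (g := fun c => g #c.support)
    (Quotient.lift σ.cycleOf fun _ _ h => SameCycle.cycleOf_eq h) ?_ ?_ ?_ ?_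
  · intro q hq
    obtain ⟨x, hx, rfl⟩ := Finset.mem_filter_univ _ |>.1 hq
    exact cycleOf_mem_cycleFactorsFinset_iff.2 hx
  · intro q hq q' hq' h
    obtain ⟨x, -, rfl⟩ := Finset.mem_filter_univ _ |>.1 hq
    obtain ⟨y, hy, rfl⟩ := Finset.mem_filter_univ _ |>.1 hq'
    have hxy : y ∈ (σ.cycleOf x).support := by
      rw [show σ.cycleOf x = σ.cycleOf y from h]
      exact mem_support_cycleOf_iff.2 ⟨.refl _ _, hy⟩
    exact Quotient.sound (mem_support_cycleOf_iff.1 hxy).1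
  · intro c hc
    obtain ⟨x, hx⟩ := (mem_cycleFactorsFinset_iff.1 hc).1.nonempty_support
    exact ⟨Quotient.mk _ x, (Finset.mem_filter_univ _).2
      ⟨x, mem_cycleFactorsFinset_support_le hc hx, rfl⟩, (cycle_is_cycleOf hx hc).symm⟩
  · intro q hq
    obtain ⟨x, hx, rfl⟩ := Finset.mem_filter_univ _ |>.1 hq
    rw [filter_mk_eq_of_mem_support σ hx]
    rfl

open scoped Classical in
lemma prod_fixed_cycles (g : ℕ → M) :
    ∏ q : Quotient (SameCycle.setoid σ) with ¬ ∃ x ∈ σ.support, Quotient.mk _ x = q,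
      g #{r | Quotient.mk _ r = q} = ∏ _ ∈ σ.supportᶜ, g 1 := by
  have eq_of_mk_eq {x y : ι} (hy : y ∉ σ.support)
      (h : Quotient.mk (SameCycle.setoid σ) x = Quotient.mk _ y) : x = y := by
    rw [← Finset.mem_singleton, ← filter_mk_eq_of_notMem_support σ hy]
    exact (Finset.mem_filter_univ _).2 h
  symm
  refine Finset.prod_nbij (Quotient.mk _) ?_ ?_ ?_ ?_
  · intro x hx
    rw [Finset.mem_compl] at hx
    refine (Finset.mem_filter_univ _).2 ?_
    rintro ⟨y, hy, hyx⟩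
    exact hx (eq_of_mk_eq hx hyx ▸ hy)
  · intro x _ y hy hxy
    exact eq_of_mk_eq (Finset.mem_compl.1 hy) hxy
  · intro q hq
    obtain ⟨x, rfl⟩ := Quotient.exists_rep q
    exact ⟨x, Finset.mem_compl.2 fun hx => (Finset.mem_filter_univ _).1 hq ⟨x, hx, rfl⟩, rfl⟩
  · intro x hx
    rw [filter_mk_eq_of_notMem_support σ (Finset.mem_compl.1 hx), Finset.card_singleton]

open scoped Classical in
lemma prod_cycles_eq_prod_parts (g : ℕ → M) :
    ∏ q : Quotient (SameCycle.setoid σ), g #{r | Quotient.mk _ r = q} =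
      (σ.partition.parts.map g).prod := by
  rw [← Finset.prod_filter_mul_prod_filter_not Finset.univ
      fun q => ∃ x ∈ σ.support, Quotient.mk _ x = q, prod_moved_cycles, prod_fixed_cycles,
    parts_partition, Multiset.map_add, Multiset.prod_add, Finset.prod_const, Finset.card_compl,
    Multiset.map_replicate, Multiset.prod_replicate]

end CycleProducts

section FixedColorings

open Equiv.Perm

variable {ι n R : Type*}

lemma eq_of_sameCycle [Finite ι] {σ : Equiv.Perm ι} {i : ι → n} (hi : i ∘ σ = i) {r s : ι}
    (h : σ.SameCycle r s) : i r = i s := by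
  obtain ⟨k, rfl⟩ := h.exists_nat_pow_eq
  have hsemi : Function.Semiconj i σ id := congrFun hi
  rw [coe_pow, (hsemi.iterate_right k).eq, Function.iterate_id, id]

lemma comp_eq_of_forall_le [Finite ι] [PartialOrder n] {σ : Equiv.Perm ι} {i : ι → n}
    (hi : ∀ r, i r ≤ i (σ r)) : i ∘ σ = i := by
  have le_pow (k : ℕ) (r : ι) : i r ≤ i ((σ ^ k) r) := by
    induction k with
    | zero => rfl
    | succ k ih => exact ih.trans (pow_succ' σ k ▸ hi _)
  ext1 r
  obtain ⟨k, hk⟩ := (sameCycle_apply_left.2 (SameCycle.refl σ r)).exists_nat_pow_eq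
  exact le_antisymm ((le_pow k _).trans_eq (congrArg i hk)) (hi r)

variable [Fintype ι] [DecidableEq ι] [Fintype n] [DecidableEq n] [CommSemiring R]

lemma sum_fixed_colorings (σ : Equiv.Perm ι) (x : n → R) :
    ∑ i : ι → n with i ∘ σ = i, ∏ r, x (i r) =
      (σ.partition.parts.map fun k => ∑ j, x j ^ k).prod := by
  classical
  rw [← prod_cycles_eq_prod_parts σ fun k => ∑ j, x j ^ k, Finset.prod_univ_sum,
    Fintype.piFinset_univ]
  let s := SameCycle.setoid σ
  symm
  refine Finset.sum_nbij (fun h r => h (Quotient.mk s r)) ?_ ?_ ?_ ?_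
  · intro h _
    refine (Finset.mem_filter_univ _).2 (funext fun r => congrArg h (Quotient.sound ?_))
    exact sameCycle_apply_left.2 (.refl _ _)
  · intro h _ h' _ hh
    ext1 q
    obtain ⟨r, rfl⟩ := Quotient.exists_rep q
    exact congrFun hh r
  · intro i hi
    have hi' : i ∘ σ = i := (Finset.mem_filter.1 hi).2
    exact ⟨Quotient.lift i fun _ _ h => eq_of_sameCycle hi' h,
      Finset.mem_coe.2 (Finset.mem_univ _), rfl⟩
  · intro h _
    rw [← Finset.prod_fiberwise Finset.univ (Quotient.mk s) fun r => x (h (Quotient.mk s r))]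
    refine Finset.prod_congr rfl fun q _ => ?_
    rw [← Finset.prod_const]
    refine Finset.prod_congr rfl fun r hr => ?_
    rw [(Finset.mem_filter_univ _).1 hr]

lemma sum_prod_of_isLowerTriangular [LinearOrder n] {M : Matrix n n R}
    (hM : M.IsLowerTriangular) (σ : Equiv.Perm ι) :
    ∑ i : ι → n, ∏ r, M (i (σ r)) (i r) = ∑ i : ι → n with i ∘ σ = i, ∏ r, M (i r) (i r) := by
  rw [Finset.sum_filter]
  refine Finset.sum_congr rfl fun i _ => ?_
  split_ifs with hi
  · exact Finset.prod_congr rfl fun r _ => by rw [← Function.comp_apply (f := i), hi]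
  · obtain ⟨r, hr⟩ : ∃ r, i (σ r) < i r := by
      by_contra! hle
      exact hi (comp_eq_of_forall_le hle)
    exact Finset.prod_eq_zero (Finset.mem_univ r) (hM hr)

end FixedColorings

section Triangularization

variable {K V : Type*} [Field K] [AddCommGroup V] [Module K V]

lemma exists_basis_extending_ker {φ : Module.Dual K V} (hφ : φ ≠ 0) {n : ℕ}
    (b : Module.Basis (Fin n) K (LinearMap.ker φ)) :
    ∃ B : Module.Basis (Fin (n + 1)) K V, ∀ v : LinearMap.ker φ,
      B.repr v = (b.repr v).mapDomain Fin.succ := by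
  obtain ⟨y, hy⟩ := DFunLike.exists_ne hφ
  rw [LinearMap.zero_apply] at hy
  let B := Module.Basis.mkFinCons y b
    (fun c x hx h => by
      have hφcy := congrArg φ h
      rw [map_add, map_smul, LinearMap.mem_ker.1 hx, add_zero, map_zero, smul_eq_mul] at hφcy
      exact (mul_eq_zero.1 hφcy).resolve_right hy)
    (fun z => ⟨-(φ z / φ y), by
      rw [LinearMap.mem_ker, map_add, map_smul, smul_eq_mul, neg_mul, div_mul_cancel₀ _ hy,
        add_neg_cancel]⟩)
  have hB (k : Fin n) : B k.succ = b k := by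
    simp only [B, Module.Basis.coe_mkFinCons, Fin.cons_succ, Function.comp_apply]
  have hrepr : B.repr.toLinearMap ∘ₗ (LinearMap.ker φ).subtype =
      Finsupp.lmapDomain K K Fin.succ ∘ₗ b.repr.toLinearMap := by
    refine b.ext fun k => ?_
    simp only [LinearMap.comp_apply, Submodule.subtype_apply, LinearEquiv.coe_coe, ← hB,
      Module.Basis.repr_self, Finsupp.lmapDomain_apply, Finsupp.mapDomain_single]
  exact ⟨B, DFunLike.congr_fun hrepr⟩

variable [FiniteDimensional K V] [IsAlgClosed K]

lemma exists_dual_eigenvector [Nontrivial V] (f : Module.End K V) :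
    ∃ φ : Module.Dual K V, φ ≠ 0 ∧ ∃ μ : K, ∀ v, φ (f v) = μ * φ v := by
  obtain ⟨μ, hμ⟩ := Module.End.exists_eigenvalue (Module.Dual.transpose f)
  obtain ⟨φ, hφ⟩ := hμ.exists_hasEigenvector
  exact ⟨φ, hφ.2, μ, LinearMap.congr_fun hφ.apply_eq_smul⟩

lemma exists_isLowerTriangular_toMatrix {n : ℕ} (hn : Module.finrank K V = n)
    (f : Module.End K V) :
    ∃ b : Module.Basis (Fin n) K V, (LinearMap.toMatrix b b f).IsLowerTriangular := by
  induction n generalizing V with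
  | zero => exact ⟨Module.finBasisOfFinrankEq K V hn, fun i => i.elim0⟩
  | succ n ih =>
    have : Nontrivial V := Module.nontrivial_of_finrank_pos (R := K) (by omega)
    obtain ⟨φ, hφ, μ, hf⟩ := exists_dual_eigenvector f
    have hinv : ∀ v ∈ LinearMap.ker φ, f v ∈ LinearMap.ker φ := fun v hv => by
      rw [LinearMap.mem_ker] at hv ⊢
      rw [hf, hv, mul_zero]
    have hrank := Module.Dual.finrank_ker_add_one_of_ne_zero hφ
    obtain ⟨b, hb⟩ := ih (V := LinearMap.ker φ) (by omega) (f.restrict hinv)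
    obtain ⟨B, hB⟩ := exists_basis_extending_ker hφ b
    have hBsucc (k : Fin n) : B k.succ = b k := B.repr.injective <| by
      rw [hB, b.repr_self, B.repr_self, Finsupp.mapDomain_single]
    refine ⟨B, fun i j hij => ?_⟩
    obtain ⟨k, rfl⟩ := Fin.exists_succ_eq.2 (Fin.ne_zero_of_lt (OrderDual.toDual_lt_toDual.1 hij))
    have hfB : f (B k.succ) = f.restrict hinv (b k) := by rw [hBsucc, LinearMap.coe_restrict_apply]
    rw [LinearMap.toMatrix_apply, hfB, hB]
    induction i using Fin.cases with
    | zero =>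
      rw [Finsupp.mapDomain_of_notMem_range]
      rintro ⟨m, hm⟩
      exact Fin.succ_ne_zero m hm
    | succ m =>
      rw [Finsupp.mapDomain_apply (Fin.succ_injective n), ← LinearMap.toMatrix_apply]
      exact hb (Fin.succ_lt_succ_iff.1 hij)

lemma exists_isLowerTriangular_conj {N : ℕ} (A : Matrix (Fin N) (Fin N) K) :
    ∃ P M Q : Matrix (Fin N) (Fin N) K, M.IsLowerTriangular ∧ Q * P = 1 ∧ A = P * M * Q := by
  obtain ⟨b, hb⟩ := exists_isLowerTriangular_toMatrix (Module.finrank_fin_fun K) (Matrix.toLin' A)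
  let e := Pi.basisFun K (Fin N)
  refine ⟨e.toMatrix b, _, b.toMatrix e, hb, Module.Basis.toMatrix_mul_toMatrix_flip _ _, ?_⟩
  rw [basis_toMatrix_mul_linearMap_toMatrix_mul_basis_toMatrix,
    LinearMap.toMatrix_eq_toMatrix', LinearMap.toMatrix'_toLin']

end Triangularization

section PowerSum

variable {N d : ℕ} {A : Matrix (Fin N) (Fin N) ℂ} {a b : Fin N → ℂ}

lemma powerSum_eq (α : d.Partition) (x : Fin N → ℂ) :
    powerSum α x = (α.parts.map fun k => ∑ j, x j ^ k).prod := by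
  rw [powerSum, MvPolynomial.psumPart, map_multiset_prod, Multiset.map_map]
  congr! 3 with k
  simp only [Function.comp_apply, MvPolynomial.psum, map_sum, map_pow, MvPolynomial.eval_X]

lemma isEigenvalueList_diag (hA : A.IsLowerTriangular) : IsEigenvalueList A A.diag := by
  rw [IsEigenvalueList, ← Matrix.charpoly_transpose, Matrix.charpoly_of_isUpperTriangular]
  · rfl
  · exact hA.transpose

lemma IsEigenvalueList.map_univ_eq (ha : IsEigenvalueList A a) (hb : IsEigenvalueList A b) :
    Finset.univ.val.map a = Finset.univ.val.map b := by
  have roots_charpoly {x : Fin N → ℂ} (hx : IsEigenvalueList A x) :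
      A.charpoly.roots = Finset.univ.val.map x := by
    rw [hx, ← Polynomial.roots_multiset_prod_X_sub_C (Finset.univ.val.map x), Multiset.map_map]
    rfl
  rw [← roots_charpoly ha, roots_charpoly hb]

lemma IsEigenvalueList.powerSum_eq (ha : IsEigenvalueList A a) (hb : IsEigenvalueList A b)
    (α : d.Partition) : powerSum α a = powerSum α b := by
  have hsum (k : ℕ) : ∑ j, a j ^ k = ∑ j, b j ^ k := by
    have h := congr(($(ha.map_univ_eq hb)).map (· ^ k) |>.sum)
    rwa [Multiset.map_map, Multiset.map_map] at h
  simp only [StringExpansion.powerSum_eq, hsum]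

theorem trace_tensorPow_mul_permMat_eq_powerSum (ha : IsEigenvalueList A a) {α : d.Partition}
    {σ : Equiv.Perm (Fin d)} (hσ : σ ∈ conjClass α) :
    (tensorPow (Fin d) A * permMat (Fin N) ℂ σ).trace = powerSum α a := by
  obtain ⟨P, M, Q, hM, hQP, rfl⟩ := exists_isLowerTriangular_conj A
  have hconj : (tensorPow (Fin d) (P * M * Q) * permMat (Fin N) ℂ σ).trace =
      (tensorPow (Fin d) M * permMat (Fin N) ℂ σ).trace := by
    rw [tensorPow_mul, tensorPow_mul, mul_assoc, mul_assoc, Matrix.trace_mul_comm,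
      ← (commute_permMat_tensorPow σ Q).eq, mul_assoc, mul_assoc, ← tensorPow_mul, hQP,
      tensorPow_one, mul_one]
  have hdiag : IsEigenvalueList (P * M * Q) M.diag := by
    rw [IsEigenvalueList, Matrix.charpoly_mul_comm, ← mul_assoc, hQP, one_mul]
    exact isEigenvalueList_diag hM
  rw [hconj, trace_tensorPow_mul_permMat, sum_prod_of_isLowerTriangular hM,
    ha.powerSum_eq hdiag, powerSum_eq, ← mem_conjClass.1 hσ]
  exact sum_fixed_colorings σ M.diag

end PowerSum

/-! ### Averages over the unitary group -/

section TraceElement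

variable {ι n R : Type*} [Fintype ι] [DecidableEq ι] [Fintype n] [DecidableEq n] [CommSemiring R]

/-- The element `∑ σ, Tr (X σ⁻¹) σ` of the group algebra, which depends on `X` through its traces
against the permutations of the tensor factors only. For `X = 1` its coefficients are the values of
the character of tensor space at the inverses. -/
def traceElement (X : Matrix (ι → n) (ι → n) R) : MonoidAlgebra R (Equiv.Perm ι) :=
  ∑ σ, single σ (X * permMat n R σ⁻¹).trace

lemma traceElement_tensorRep (x : MonoidAlgebra R (Equiv.Perm ι)) :
    traceElement (tensorRep n x) = traceElement (1 : Matrix (ι → n) (ι → n) R) * x := by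
  simp only [traceElement]
  induction x using MonoidAlgebra.induction_on with
  | of τ =>
    rw [MonoidAlgebra.of_apply, tensorRep_single, one_smul, Finset.sum_mul]
    refine Fintype.sum_equiv (Equiv.mulRight τ⁻¹) _ _ fun σ => ?_
    rw [Equiv.coe_mulRight, MonoidAlgebra.single_mul_single, mul_one, one_mul, ← map_mul,
      inv_mul_cancel_right, mul_inv_rev, inv_inv]
  | add x y hx hy =>
    rw [mul_add, ← hx, ← hy, ← Finset.sum_add_distrib]
    simp only [map_add, add_mul, Matrix.trace_add, MonoidAlgebra.single_add]
  | smul c x hx =>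
    rw [mul_smul_comm, ← hx, Finset.smul_sum]
    simp only [map_smul, smul_mul_assoc, Matrix.trace_smul, MonoidAlgebra.smul_single]

lemma traceElement_one_mem_center : traceElement (1 : Matrix (ι → n) (ι → n) R) ∈
    Subalgebra.center R (MonoidAlgebra R (Equiv.Perm ι)) := by
  refine mem_center_of_commute_single fun g => ?_
  rw [traceElement, Finset.mul_sum, Finset.sum_mul]
  refine Fintype.sum_equiv (MulAut.conj g).toEquiv _ _ fun σ => ?_
  have htrace : (permMat n R (g * σ * g⁻¹)⁻¹).trace = (permMat n R σ⁻¹).trace := by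
    rw [mul_inv_rev, mul_inv_rev, inv_inv, map_mul, Matrix.trace_mul_comm, ← map_mul, mul_assoc,
      inv_mul_cancel, mul_one]
  rw [MulEquiv.toEquiv_eq_coe, EquivLike.coe_coe, MulAut.conj_apply, one_mul, one_mul, htrace,
    MonoidAlgebra.single_mul_single, MonoidAlgebra.single_mul_single, one_mul, mul_one,
    inv_mul_cancel_right]

end TraceElement

section Weingarten

variable {N d : ℕ}

lemma trace_lsmul_traceElement_one (N : ℕ) (lam : d.Partition) :
    LinearMap.trace ℂ (irrepV lam) (Algebra.lsmul ℂ ℂ (irrepV lam)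
      (traceElement (1 : Matrix (Fin d → Fin N) (Fin d → Fin N) ℂ))) =
      d.factorial * dimW N lam := by
  calc
    _ = ∑ σ, (permMat (Fin N) ℂ σ⁻¹).trace * character lam σ := by
      rw [traceElement, map_sum, map_sum]
      refine Finset.sum_congr rfl fun σ _ => ?_
      rw [one_mul, ← mul_one (Matrix.trace _), ← smul_eq_mul, ← MonoidAlgebra.smul_single, map_smul,
        map_smul, smul_eq_mul, smul_eq_mul, mul_one, character, MonoidAlgebra.of_apply]
    _ = quasiScalar (youngSymmetrizer lam) *
        ∑ σ, (youngCentralIdem lam).coeff σ * (permMat (Fin N) ℂ σ).trace := by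
      rw [Finset.mul_sum]
      refine Fintype.sum_equiv (Equiv.inv _) _ _ fun σ => ?_
      rw [coeff_youngCentralIdem, Equiv.inv_apply, inv_inv]
      field_simp [quasiScalar_youngSymmetrizer_ne_zero lam]
    _ = quasiScalar (youngSymmetrizer lam) * (tensorRep (Fin N) (youngCentralIdem lam)).trace := by
      rw [tensorRep_eq_sum, Matrix.trace_sum]
      simp only [Matrix.trace_smul, smul_eq_mul]
    _ = d.factorial * dimW N lam := by
      rw [trace_tensorRep_youngCentralIdem, ← mul_assoc, quasiScalar_youngSymmetrizer_mul_dimV]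

lemma traceElement_one_eq :
    traceElement (1 : Matrix (Fin d → Fin N) (Fin d → Fin N) ℂ) =
      ∑ lam : d.Partition, ((d.factorial : ℂ) * dimW N lam / dimV lam) • youngCentralIdem lam := by
  conv_lhs => rw [eq_sum_smul_youngCentralIdem traceElement_one_mem_center]
  simp only [trace_lsmul_traceElement_one]

lemma sum_smul_youngCentralIdem_mul (s t : d.Partition → ℂ) :
    (∑ lam, s lam • youngCentralIdem lam) * ∑ lam, t lam • youngCentralIdem lam =
      ∑ lam, (s lam * t lam) • youngCentralIdem lam := by
  rw [Finset.sum_mul]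
  refine Finset.sum_congr rfl fun lam _ => ?_
  rw [Finset.mul_sum, Fintype.sum_eq_single lam, smul_mul_smul_comm, youngCentralIdem_mul_self]
  intro mu hmu
  rw [smul_mul_smul_comm, youngCentralIdem_mul_of_ne hmu.symm, smul_zero]

/-- The Weingarten element: the inverse of `traceElement 1` on the blocks of the group algebra that
act nontrivially on tensor space. On the other blocks it vanishes, by division by zero. -/
def weingarten (N d : ℕ) : GroupAlg d :=
  ∑ lam : d.Partition, ((dimV lam : ℂ) / (d.factorial * dimW N lam)) • youngCentralIdem lam

lemma weingarten_mem_center (N d : ℕ) : weingarten N d ∈ Subalgebra.center ℂ (GroupAlg d) :=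
  Subalgebra.sum_mem _ fun _ _ => Subalgebra.smul_mem _ (centralIdem_mem_center _) _

lemma tensorRep_weingarten_mul_traceElement_one :
    tensorRep (Fin N) (weingarten N d *
      traceElement (1 : Matrix (Fin d → Fin N) (Fin d → Fin N) ℂ)) = 1 := by
  rw [traceElement_one_eq, weingarten, sum_smul_youngCentralIdem_mul, ← map_one (tensorRep (Fin N)),
    ← sum_youngCentralIdem, map_sum, map_sum]
  refine Finset.sum_congr rfl fun lam _ => ?_
  by_cases hW : dimW N lam = 0
  · rw [map_smul, tensorRep_youngCentralIdem_eq_zero hW, smul_zero]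
  · have hd : (d.factorial : ℂ) ≠ 0 := Nat.cast_ne_zero.2 d.factorial_ne_zero
    rw [div_mul_div_cancel₀ (mul_ne_zero hd (Nat.cast_ne_zero.2 hW)), div_self (dimV_ne_zero lam),
      one_smul]

lemma tensorRep_weingarten_mul_traceElement_tensorRep (x : GroupAlg d) :
    tensorRep (Fin N) (weingarten N d * traceElement (tensorRep (Fin N) x)) =
      tensorRep (Fin N) x := by
  rw [traceElement_tensorRep, ← mul_assoc, map_mul, tensorRep_weingarten_mul_traceElement_one,
    one_mul]

end Weingarten

section UnitaryAverage

open scoped Matrix.Norms.Elementwise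

variable {N d : ℕ}

instance instIsProbabilityMeasureHaarU (N : ℕ) : IsProbabilityMeasure (haarU N) :=
  ⟨Measure.haarMeasure_self⟩

instance instIsHaarMeasureHaarU (N : ℕ) : (haarU N).IsHaarMeasure := by
  unfold haarU
  infer_instance

lemma integrable_of_continuous_of_compactSpace {X E : Type*} [TopologicalSpace X] [CompactSpace X]
    [MeasurableSpace X] [OpensMeasurableSpace X] [NormedAddCommGroup E] {μ : Measure X}
    [IsFiniteMeasureOnCompacts μ] {f : X → E} (hf : Continuous f) : Integrable f μ :=
  hf.integrable_of_hasCompactSupport (HasCompactSupport.of_compactSpace f)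

lemma continuous_tensorPow (ι n R : Type*) [Fintype ι] [CommSemiring R] [TopologicalSpace R]
    [ContinuousMul R] : Continuous (tensorPow ι : Matrix n n R → _) := by
  refine continuous_matrix fun i j => ?_
  simp only [tensorPow_apply]
  fun_prop

/-- The conjugate of a matrix on tensor space by a tensor power of a unitary matrix. -/
def unitaryConj (X : Matrix (Fin d → Fin N) (Fin d → Fin N) ℂ) (U : UGroup N) :
    Matrix (Fin d → Fin N) (Fin d → Fin N) ℂ :=
  tensorPow (Fin d) U.1 * X * tensorPow (Fin d) (U⁻¹).1

lemma continuous_unitaryConj (X : Matrix (Fin d → Fin N) (Fin d → Fin N) ℂ) :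
    Continuous (unitaryConj X) :=
  (((continuous_tensorPow _ _ _).comp continuous_subtype_val).mul continuous_const).mul
    ((continuous_tensorPow _ _ _).comp (continuous_subtype_val.comp continuous_inv))

lemma tensorPow_inv_mul (U : UGroup N) :
    tensorPow (Fin d) (U⁻¹).1 * tensorPow (Fin d) U.1 = 1 := by
  rw [← tensorPow_mul, ← Submonoid.coe_mul, inv_mul_cancel, Submonoid.coe_one, tensorPow_one]

/-- The Haar average of the conjugates of `X`, which is the projection of `X` to the commutant of
the unitary group on tensor space. -/
def unitaryAverage (X : Matrix (Fin d → Fin N) (Fin d → Fin N) ℂ) :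
    Matrix (Fin d → Fin N) (Fin d → Fin N) ℂ :=
  ∫ U, unitaryConj X U ∂haarU N

lemma map_unitaryAverage {E : Type*} [NormedAddCommGroup E] [NormedSpace ℂ E] [CompleteSpace E]
    (X : Matrix (Fin d → Fin N) (Fin d → Fin N) ℂ)
    (f : Matrix (Fin d → Fin N) (Fin d → Fin N) ℂ →ₗ[ℂ] E) :
    f (unitaryAverage X) = ∫ U, f (unitaryConj X U) ∂haarU N :=
  ((LinearMap.toContinuousLinearMap f).integral_comp_comm
    (integrable_of_continuous_of_compactSpace (continuous_unitaryConj X))).symm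

lemma trace_mul_unitaryAverage (M X : Matrix (Fin d → Fin N) (Fin d → Fin N) ℂ) :
    (M * unitaryAverage X).trace = ∫ U, (M * unitaryConj X U).trace ∂haarU N :=
  map_unitaryAverage X (Matrix.traceLinearMap _ ℂ ℂ ∘ₗ LinearMap.mulLeft ℂ M)

lemma commute_unitaryAverage (X : Matrix (Fin d → Fin N) (Fin d → Fin N) ℂ) (V : UGroup N) :
    Commute (unitaryAverage X) (tensorPow (Fin d) V.1) := by
  have hV : tensorPow (Fin d) V.1 * unitaryAverage X * tensorPow (Fin d) (V⁻¹).1 =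
      unitaryAverage X := by
    calc
      _ = ∫ U, tensorPow (Fin d) V.1 * unitaryConj X U * tensorPow (Fin d) (V⁻¹).1 ∂haarU N :=
        map_unitaryAverage X (LinearMap.mulRight ℂ (tensorPow (Fin d) (V⁻¹).1) ∘ₗ
          LinearMap.mulLeft ℂ (tensorPow (Fin d) V.1))
      _ = ∫ U, unitaryConj X (V * U) ∂haarU N := by
        simp only [unitaryConj, mul_inv_rev, Submonoid.coe_mul, tensorPow_mul, mul_assoc]
      _ = unitaryAverage X := integral_mul_left_eq_self (unitaryConj X) V
  rw [Commute, SemiconjBy]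
  conv_lhs => rw [← hV, mul_assoc, tensorPow_inv_mul, mul_one]

lemma traceElement_unitaryAverage (X : Matrix (Fin d → Fin N) (Fin d → Fin N) ℂ) :
    traceElement (unitaryAverage X) = traceElement X := by
  refine Finset.sum_congr rfl fun σ _ => ?_
  have hconj (U : UGroup N) :
      (permMat (Fin N) ℂ σ⁻¹ * unitaryConj X U).trace = (X * permMat (Fin N) ℂ σ⁻¹).trace := by
    rw [unitaryConj, mul_assoc, ← mul_assoc, (commute_permMat_tensorPow σ⁻¹ U.1).eq, mul_assoc,
      Matrix.trace_mul_comm, mul_assoc, mul_assoc, tensorPow_inv_mul, mul_one,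
      Matrix.trace_mul_comm]
  rw [Matrix.trace_mul_comm, trace_mul_unitaryAverage]
  simp only [hconj, integral_const, probReal_univ, one_smul]

/-- The **Weingarten formula**. -/
theorem unitaryAverage_eq (X : Matrix (Fin d → Fin N) (Fin d → Fin N) ℂ) :
    unitaryAverage X = tensorRep (Fin N) (weingarten N d * traceElement X) := by
  obtain ⟨x, hx⟩ := exists_tensorRep_eq_of_commute_unitary (commute_unitaryAverage X)
  rw [← traceElement_unitaryAverage, ← hx, tensorRep_weingarten_mul_traceElement_tensorRep]

end UnitaryAverage

section Moments

open scoped Matrix.Norms.Elementwise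

variable {N d : ℕ} {A B : Matrix (Fin N) (Fin N) ℂ} {a b c : Fin N → ℂ}

lemma trace_tensorPow_mul_tensorRep_youngCentralIdem (ha : IsEigenvalueList A a)
    (lam : d.Partition) :
    (tensorPow (Fin d) A * tensorRep (Fin N) (youngCentralIdem lam)).trace =
      (dimV lam : ℂ) ^ 2 / d.factorial * ∑ α : d.Partition, powerSum α a * omega α lam := by
  rw [tensorRep_eq_sum, Finset.mul_sum, Matrix.trace_sum, sum_perm_eq_sum_conjClass,
    Finset.mul_sum]
  refine Finset.sum_congr rfl fun α _ => ?_
  rw [mul_left_comm, ← sum_conjClass_coeff_youngCentralIdem, Finset.mul_sum]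
  refine Finset.sum_congr rfl fun σ hσ => ?_
  rw [mul_smul_comm, Matrix.trace_smul, trace_tensorPow_mul_permMat_eq_powerSum ha hσ,
    smul_eq_mul, mul_comm]

lemma trace_tensorPow_mul_tensorRep_sum (ha : IsEigenvalueList A a) (s : d.Partition → ℂ) :
    (tensorPow (Fin d) A * tensorRep (Fin N) (∑ lam, s lam • youngCentralIdem lam)).trace =
      ∑ α : d.Partition, powerSum α a *
        ∑ lam, s lam * ((dimV lam : ℂ) ^ 2 / d.factorial * omega α lam) := by
  simp only [map_sum, map_smul, Finset.mul_sum, mul_smul_comm, Matrix.trace_sum,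
    Matrix.trace_smul, trace_tensorPow_mul_tensorRep_youngCentralIdem ha, smul_eq_mul]
  rw [Finset.sum_comm]
  refine Finset.sum_congr rfl fun α _ => Finset.sum_congr rfl fun lam _ => ?_
  ring

lemma traceElement_tensorPow (hb : IsEigenvalueList B b) :
    traceElement (tensorPow (Fin d) B) =
      ∑ lam : d.Partition, (∑ β : d.Partition, powerSum β b * omega β lam) •
        youngCentralIdem lam := by
  calc
    _ = ∑ β : d.Partition, powerSum β b • classSum β := by
      rw [traceElement, sum_perm_eq_sum_conjClass]
      refine Finset.sum_congr rfl fun β _ => ?_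
      rw [classSum, Finset.smul_sum]
      refine Finset.sum_congr rfl fun σ hσ => ?_
      rw [trace_tensorPow_mul_permMat_eq_powerSum hb (inv_mem_conjClass.2 hσ),
        MonoidAlgebra.smul_single, smul_eq_mul, mul_one]
    _ = _ := by
      simp only [classSum_eq, Finset.smul_sum, smul_smul, Finset.sum_smul]
      exact Finset.sum_comm

theorem integral_trace_conj_pow (d : ℕ) (ha : IsEigenvalueList A a) (hb : IsEigenvalueList B b) :
    ∫ U : UGroup N, (A * U.1 * B * (U⁻¹).1).trace ^ d ∂haarU N =
      ∑ α : d.Partition, ∑ β : d.Partition, powerSum α a * powerSum β b *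
        ∑ lam : d.Partition, (dimV lam : ℂ) ^ 3 / ((d.factorial : ℂ) ^ 2 * dimW N lam) *
          (omega α lam * omega β lam) := by
  calc
    _ = ∫ U, (tensorPow (Fin d) A * unitaryConj (tensorPow (Fin d) B) U).trace ∂haarU N := by
      refine integral_congr_ae (.of_forall fun U => ?_)
      simpa only [unitaryConj, ← mul_assoc, tensorPow_mul, Fintype.card_fin] using
        (trace_tensorPow (ι := Fin d) (A * U.1 * B * (U⁻¹).1)).symm
    _ = (tensorPow (Fin d) A * tensorRep (Fin N) (∑ lam : d.Partition,
          ((dimV lam : ℂ) / (d.factorial * dimW N lam) *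
            ∑ β : d.Partition, powerSum β b * omega β lam) • youngCentralIdem lam)).trace := by
      rw [← trace_mul_unitaryAverage, unitaryAverage_eq, traceElement_tensorPow hb, weingarten,
        sum_smul_youngCentralIdem_mul]
    _ = _ := by
      rw [trace_tensorPow_mul_tensorRep_sum ha]
      refine Finset.sum_congr rfl fun α _ => ?_
      simp only [Finset.mul_sum, Finset.sum_mul]
      rw [Finset.sum_comm]
      refine Finset.sum_congr rfl fun β _ => Finset.sum_congr rfl fun lam _ => ?_
      ring

lemma sum_trace_mul_single_mul_mul_single {ι R : Type*} [Fintype ι] [DecidableEq ι]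
    [CommSemiring R] (P Q : Matrix ι ι R) :
    ∑ i, ∑ j, (Q * (Matrix.single j i 1 * P * Matrix.single i j 1)).trace =
      P.trace * Q.trace := by
  simp only [Matrix.single_mul_mul_single, one_mul, mul_one, Matrix.trace_mul_single]
  simp only [Matrix.trace, Matrix.diag_apply, Finset.sum_mul_sum]
  simp only [op_smul_eq_mul, mul_comm]

lemma sum_trace_single_mul_mul_trace_single_mul {ι R : Type*} [Fintype ι] [DecidableEq ι]
    [CommSemiring R] (X Y : Matrix ι ι R) :
    ∑ i, ∑ j, (Matrix.single i j 1 * X).trace * (Matrix.single j i 1 * Y).trace =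
      (X * Y).trace := by
  simp only [Matrix.trace_single_mul, one_smul]
  simp only [Matrix.trace, Matrix.diag_apply, Matrix.mul_apply]
  exact Finset.sum_comm

theorem integral_trace_mul_trace_inv (X Y : Matrix (Fin d → Fin N) (Fin d → Fin N) ℂ) :
    ∫ U : UGroup N, (X * tensorPow (Fin d) U.1).trace * (Y * tensorPow (Fin d) (U⁻¹).1).trace
        ∂haarU N =
      ∑ σ, (permMat (Fin N) ℂ σ⁻¹ *
        (X * tensorRep (Fin N) (weingarten N d) * permMat (Fin N) ℂ σ * Y)).trace := by
  have hexpand (U : UGroup N) :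
      (X * tensorPow (Fin d) U.1).trace * (Y * tensorPow (Fin d) (U⁻¹).1).trace =
        ∑ i, ∑ j, (Y * Matrix.single j i 1 * X * unitaryConj (Matrix.single i j 1) U).trace := by
    rw [Matrix.trace_mul_comm Y, ← sum_trace_mul_single_mul_mul_single]
    refine Finset.sum_congr rfl fun i _ => Finset.sum_congr rfl fun j _ => ?_
    rw [unitaryConj, mul_assoc (tensorPow _ _) Y, Matrix.trace_mul_comm]
    simp only [mul_assoc]
  have hentry (i j : Fin d → Fin N) :
      ∫ U, (Y * Matrix.single j i 1 * X * unitaryConj (Matrix.single i j 1) U).trace ∂haarU N =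
        ∑ σ, (Matrix.single i j 1 * permMat (Fin N) ℂ σ⁻¹).trace * (Matrix.single j i 1 *
          (X * tensorRep (Fin N) (weingarten N d) * permMat (Fin N) ℂ σ * Y)).trace := by
    rw [← trace_mul_unitaryAverage, unitaryAverage_eq, map_mul, traceElement, map_sum,
      Finset.mul_sum, Finset.mul_sum, Matrix.trace_sum]
    refine Finset.sum_congr rfl fun σ _ => ?_
    rw [tensorRep_single, mul_smul_comm, mul_smul_comm, Matrix.trace_smul, smul_eq_mul,
      mul_assoc Y, mul_assoc Y, Matrix.trace_mul_comm Y]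
    simp only [mul_assoc]
  have hint (i j : Fin d → Fin N) : Integrable
      (fun U => (Y * Matrix.single j i 1 * X * unitaryConj (Matrix.single i j 1) U).trace)
      (haarU N) :=
    integrable_of_continuous_of_compactSpace
      (continuous_const.mul (continuous_unitaryConj _)).matrix_trace
  simp only [hexpand, ← sum_trace_single_mul_mul_trace_single_mul (permMat (Fin N) ℂ _)]
  rw [integral_finsetSum _ fun i _ => integrable_finsetSum _ fun j _ => hint i j,
    Finset.sum_comm]
  refine Finset.sum_congr rfl fun i _ => ?_
  rw [integral_finsetSum _ fun j _ => hint i j, Finset.sum_comm]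
  exact Finset.sum_congr rfl fun j _ => hentry i j

theorem integral_trace_pow_mul_trace_inv_pow (d : ℕ) (hc : IsEigenvalueList (A * B) c) :
    ∫ U : UGroup N, (A * U.1).trace ^ d * (B * (U⁻¹).1).trace ^ d ∂haarU N =
      ∑ β : d.Partition, powerSum β c *
        ∑ lam : d.Partition, (dimV lam : ℂ) ^ 3 / (d.factorial * dimW N lam) * omega β lam := by
  have hconj (σ : Equiv.Perm (Fin d)) :
      (permMat (Fin N) ℂ σ⁻¹ * (tensorPow (Fin d) A * tensorRep (Fin N) (weingarten N d) *
        permMat (Fin N) ℂ σ * tensorPow (Fin d) B)).trace =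
      (tensorPow (Fin d) (A * B) * tensorRep (Fin N) (weingarten N d)).trace := by
    have hσ : Commute (tensorRep (Fin N) (weingarten N d)) (permMat (Fin N) ℂ σ) := by
      rw [← one_smul ℂ (permMat _ _ _), ← tensorRep_single]
      have hw : Commute (weingarten N d) (single σ 1) :=
        (Subalgebra.mem_center_iff.1 (weingarten_mem_center N d) _).symm
      exact hw.map (tensorRep (Fin N))
    have hB : Commute (tensorRep (Fin N) (weingarten N d)) (tensorPow (Fin d) B) :=
      commute_tensorRep (fun τ => commute_permMat_tensorPow τ B) _
    rw [mul_assoc (tensorPow _ A), hσ.eq, ← mul_assoc (tensorPow _ A),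
      ← (commute_permMat_tensorPow σ A).eq, mul_assoc, mul_assoc, ← mul_assoc, ← map_mul,
      inv_mul_cancel, map_one, one_mul, hB.eq, ← mul_assoc, ← tensorPow_mul]
  calc
    _ = ∫ U : UGroup N, (tensorPow (Fin d) A * tensorPow (Fin d) U.1).trace *
          (tensorPow (Fin d) B * tensorPow (Fin d) (U⁻¹).1).trace ∂haarU N := by
      simp only [← tensorPow_mul, trace_tensorPow, Fintype.card_fin]
    _ = d.factorial * (tensorPow (Fin d) (A * B) * tensorRep (Fin N) (weingarten N d)).trace := by
      rw [integral_trace_mul_trace_inv]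
      simp only [hconj, Finset.sum_const, Finset.card_univ, Fintype.card_perm, Fintype.card_fin,
        nsmul_eq_mul]
    _ = _ := by
      rw [weingarten, trace_tensorPow_mul_tensorRep_sum hc, Finset.mul_sum]
      refine Finset.sum_congr rfl fun β _ => ?_
      rw [mul_left_comm, Finset.mul_sum]
      congr 1
      refine Finset.sum_congr rfl fun lam _ => ?_
      have hd : (d.factorial : ℂ) ≠ 0 := Nat.cast_ne_zero.2 d.factorial_ne_zero
      field_simp

end Moments

/-! ### The terms of the string expansions as integrals -/

section Terms

variable {N : ℕ} {A B : Matrix (Fin N) (Fin N) ℂ} {a b c : Fin N → ℂ}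

lemma lis_revPerm_le_one (d : ℕ) : lis (Fin.revPerm : Equiv.Perm (Fin d)) ≤ 1 := by
  refine Finset.sup_le fun s hs => Finset.card_le_one.2 fun x hx y hy => ?_
  have hmono := (Finset.mem_filter.1 hs).2
  rcases lt_trichotomy x y with h | h | h
  · exact absurd (Fin.rev_lt_rev.1 (hmono hx hy h)) h.not_gt
  · exact h
  · exact absurd (Fin.rev_lt_rev.1 (hmono hy hx h)) h.not_gt

lemma card_lisPerms_ne_zero (hN : 0 < N) (d : ℕ) : #(lisPerms N d) ≠ 0 :=
  Finset.card_ne_zero_of_mem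
    (Finset.mem_filter.2 ⟨Finset.mem_univ _, (lis_revPerm_le_one d).trans hN⟩)

lemma probLIS_mul_plancherel (hN : 0 < N) {d : ℕ} (f : d.Partition → ℂ) :
    (probLIS N d : ℂ) * plancherel N d (fun lam => f lam * (Omega N lam)⁻¹) =
      (N : ℂ) ^ d * ∑ lam, (dimV lam : ℂ) ^ 3 / ((d.factorial : ℂ) ^ 2 * dimW N lam) * f lam := by
  have hL : (#(lisPerms N d) : ℂ) ≠ 0 := Nat.cast_ne_zero.2 (card_lisPerms_ne_zero hN d)
  rw [plancherel, Finset.sum_filter, Finset.mul_sum, Finset.mul_sum]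
  refine Finset.sum_congr rfl fun lam _ => ?_
  split_ifs with h
  · rw [Omega, mul_inv, inv_div, inv_div, probLIS, Complex.ofReal_div, Complex.ofReal_natCast,
      Complex.ofReal_natCast]
    field_simp
  · rw [dimW_eq_zero (not_le.1 h), Nat.cast_zero, mul_zero, mul_zero, div_zero, zero_mul, mul_zero]

theorem hcizTerm_eq_integral (hN : 0 < N) (ha : IsEigenvalueList A a) (hb : IsEigenvalueList B b)
    (z : ℂ) (d : ℕ) :
    hcizTerm N d (z, a, b) = ∫ U : UGroup N,
      (z * N * (A * U.1 * B * (U⁻¹).1).trace) ^ d / d.factorial ∂haarU N := by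
  have hplancherel (α β : d.Partition) :
      (probLIS N d : ℂ) *
          plancherel N d (fun lam => omega α lam * (Omega N lam)⁻¹ * omega β lam) =
        N ^ d * ∑ lam, (dimV lam : ℂ) ^ 3 / ((d.factorial : ℂ) ^ 2 * dimW N lam) *
          (omega α lam * omega β lam) := by
    simpa only [mul_right_comm] using
      probLIS_mul_plancherel hN fun lam => omega α lam * omega β lam
  simp only [mul_pow _ (Matrix.trace _), mul_div_right_comm, integral_const_mul]
  rw [integral_trace_conj_pow d ha hb, hcizTerm]
  simp only [mul_assoc (_ / _), Finset.mul_sum, mul_left_comm (probLIS N d : ℂ), hplancherel]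
  refine Finset.sum_congr rfl fun α _ => Finset.sum_congr rfl fun β _ =>
    Finset.sum_congr rfl fun lam _ => ?_
  ring

lemma exists_mem_unitary_pow_mul_star_pow_eq_neg_one {m k : ℕ} (h : m ≠ k) :
    ∃ ζ ∈ unitary ℂ, ζ ^ m * star ζ ^ k = -1 := by
  have hmk : (m - k : ℂ) ≠ 0 := sub_ne_zero.2 (Nat.cast_injective.ne h)
  let θ : ℝ := Real.pi / (m - k)
  have hstar : star (Complex.exp (θ * Complex.I)) = Complex.exp (-(θ * Complex.I)) := by
    rw [Complex.star_def, ← Complex.exp_conj, map_mul, Complex.conj_ofReal, Complex.conj_I,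
      mul_neg]
  refine ⟨Complex.exp (θ * Complex.I), ?_, ?_⟩
  · rw [Unitary.mem_iff_self_mul_star, hstar, ← Complex.exp_add, add_neg_cancel, Complex.exp_zero]
  · rw [hstar, ← Complex.exp_nat_mul, ← Complex.exp_nat_mul, ← Complex.exp_add,
      ← Complex.exp_pi_mul_I]
    congr 1
    push_cast [θ]
    field_simp
    ring

-- Scalar unitary matrices multiply the integrand by a character, nontrivial for `m ≠ k`.
lemma integral_trace_pow_mul_trace_inv_pow_of_ne (A B : Matrix (Fin N) (Fin N) ℂ) {m k : ℕ}
    (h : m ≠ k) :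
    ∫ U : UGroup N, (A * U.1).trace ^ m * (B * (U⁻¹).1).trace ^ k ∂haarU N = 0 := by
  obtain ⟨ζ, hmem, hζ⟩ := exists_mem_unitary_pow_mul_star_pow_eq_neg_one h
  let V : UGroup N := ⟨ζ • 1, Unitary.smul_mem_of_mem hmem (one_mem _)⟩
  refine integral_eq_zero_of_mul_left_eq_neg (g := V) fun U => ?_
  have hmul : (V * U).1 = ζ • U.1 := smul_one_mul ζ U.1
  have hinv : ((V * U)⁻¹).1 = star ζ • (U⁻¹).1 := by
    rw [← Unitary.star_eq_inv, Unitary.coe_star, hmul, star_smul, ← Unitary.star_eq_inv,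
      Unitary.coe_star]
  rw [hmul, hinv, mul_smul_comm, mul_smul_comm, Matrix.trace_smul, Matrix.trace_smul,
    smul_eq_mul, smul_eq_mul, mul_pow, mul_pow, mul_mul_mul_comm, hζ, neg_one_mul]

lemma continuous_trace_mul_unitary (A : Matrix (Fin N) (Fin N) ℂ) :
    Continuous fun U : UGroup N => (A * U.1).trace :=
  (continuous_const.mul continuous_subtype_val).matrix_trace

lemma integral_trace_add_pow (A B : Matrix (Fin N) (Fin N) ℂ) (n : ℕ) :
    ∫ U : UGroup N, (A * U.1 + B * (U⁻¹).1).trace ^ n ∂haarU N =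
      ∑ p ∈ Finset.HasAntidiagonal.antidiagonal n, n.choose p.1 * ∫ U : UGroup N,
        (A * U.1).trace ^ p.1 * (B * (U⁻¹).1).trace ^ p.2 ∂haarU N := by
  simp only [Matrix.trace_add, fun U : UGroup N =>
    (Commute.all (A * U.1).trace (B * (U⁻¹).1).trace).add_pow' n, nsmul_eq_mul,
    ← integral_const_mul]
  refine integral_finsetSum _ fun p _ => integrable_of_continuous_of_compactSpace ?_
  exact continuous_const.mul (((continuous_trace_mul_unitary A).pow _).mul
    (((continuous_trace_mul_unitary B).comp continuous_inv).pow _))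

lemma integral_trace_add_pow_of_odd (A B : Matrix (Fin N) (Fin N) ℂ) {n : ℕ} (hn : Odd n) :
    ∫ U : UGroup N, (A * U.1 + B * (U⁻¹).1).trace ^ n ∂haarU N = 0 := by
  rw [integral_trace_add_pow]
  refine Finset.sum_eq_zero fun p hp => ?_
  have hne : p.1 ≠ p.2 := fun h => Nat.not_even_iff_odd.2 hn
    ⟨p.1, by rw [← Finset.HasAntidiagonal.mem_antidiagonal.1 hp, h]⟩
  rw [integral_trace_pow_mul_trace_inv_pow_of_ne A B hne, mul_zero]

lemma integral_trace_add_pow_two_mul (A B : Matrix (Fin N) (Fin N) ℂ) (d : ℕ) :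
    ∫ U : UGroup N, (A * U.1 + B * (U⁻¹).1).trace ^ (2 * d) ∂haarU N =
      d.centralBinom * ∫ U : UGroup N,
        (A * U.1).trace ^ d * (B * (U⁻¹).1).trace ^ d ∂haarU N := by
  rw [integral_trace_add_pow]
  refine Finset.sum_eq_single_of_mem (d, d)
    (Finset.HasAntidiagonal.mem_antidiagonal.2 (two_mul d).symm) fun p hp hpd => ?_
  have hne : p.1 ≠ p.2 := fun h => hpd (by
    have := Finset.HasAntidiagonal.mem_antidiagonal.1 hp
    ext <;> dsimp only <;> omega)
  rw [integral_trace_pow_mul_trace_inv_pow_of_ne A B hne, mul_zero]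

theorem bgwTerm_eq_integral (hN : 0 < N) (hc : IsEigenvalueList (A * B) c) (z : ℂ) (d : ℕ) :
    bgwTerm N d (z, c) = ∫ U : UGroup N,
      (z * N * (A * U.1 + B * (U⁻¹).1).trace) ^ (2 * d) / (2 * d).factorial ∂haarU N := by
  have hplancherel (β : d.Partition) :
      (probLIS N d : ℂ) * plancherel N d (fun lam => (Omega N lam)⁻¹ * omega β lam) =
        N ^ d * ∑ lam, (dimV lam : ℂ) ^ 3 / ((d.factorial : ℂ) ^ 2 * dimW N lam) *
          omega β lam := by
    simpa only [mul_comm] using probLIS_mul_plancherel hN fun lam => omega β lam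
  have hbinom : (d.centralBinom : ℂ) / (2 * d).factorial = 1 / (d.factorial : ℂ) ^ 2 := by
    have hd (n : ℕ) : (n.factorial : ℂ) ≠ 0 := Nat.cast_ne_zero.2 n.factorial_ne_zero
    rw [div_eq_div_iff (hd _) (pow_ne_zero _ (hd _)), one_mul, sq, ← mul_assoc]
    exact_mod_cast two_mul d ▸ Nat.add_choose_mul_factorial_mul_factorial d d
  simp only [mul_pow _ (Matrix.trace _), mul_div_right_comm, integral_const_mul]
  rw [integral_trace_add_pow_two_mul, integral_trace_pow_mul_trace_inv_pow d hc, ← mul_assoc,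
    div_mul_eq_mul_div, mul_div_assoc, hbinom, bgwTerm]
  simp only [mul_assoc (_ / _ * _), Finset.mul_sum, mul_left_comm (probLIS N d : ℂ), hplancherel]
  refine Finset.sum_congr rfl fun β _ => Finset.sum_congr rfl fun lam _ => ?_
  field_simp
  ring

end Terms

/-! ### Convergence of the expansions -/

section Convergence

variable {X Y : Type*} [TopologicalSpace X] [TopologicalSpace Y] [CompactSpace Y]
  [MeasurableSpace Y] {μ : Measure Y}

lemma hasSum_integral_pow_div_factorial [BorelSpace Y] [IsFiniteMeasure μ]
    {T : Y → ℂ} (hT : Continuous T) :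
    HasSum (fun n : ℕ => ∫ y, T y ^ n / n.factorial ∂μ) (∫ y, Complex.exp (T y) ∂μ) := by
  obtain ⟨C, hC⟩ := isCompact_univ.exists_bound_of_continuousOn hT.continuousOn
  refine hasSum_integral_of_dominated_convergence (fun n _ => C ^ n / n.factorial)
    (fun n => ((hT.pow n).div_const _).aestronglyMeasurable)
    (fun n => .of_forall fun y => ?_) (.of_forall fun _ => Real.summable_pow_div_factorial C)
    (integrable_const _) (.of_forall fun y => ?_)
  · rw [norm_div, norm_pow, Complex.norm_natCast]
    gcongr
    exact hC y trivial
  · rw [Complex.exp_eq_exp_ℂ]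
    exact NormedSpace.expSeries_div_hasSum_exp (T y)

lemma convergesAbsUnifOnCompacts_of_bound {f : ℕ → X → ℂ}
    (h : ∀ K : Set X, IsCompact K → ∃ u : ℕ → ℝ, Summable u ∧ ∀ d, ∀ x ∈ K, ‖f d x‖ ≤ u d) :
    ConvergesAbsUnifOnCompacts f := by
  refine ⟨fun x => ?_, fun K hK => ?_⟩
  · obtain ⟨u, hu, hbound⟩ := h {x} isCompact_singleton
    exact .of_nonneg_of_le (fun _ => norm_nonneg _) (fun d => hbound (d + 1) x rfl)
      ((summable_nat_add_iff 1).2 hu)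
  · obtain ⟨u, hu, hbound⟩ := h K hK
    have hu' := (summable_nat_add_iff 1).2 hu
    exact ⟨tendstoUniformlyOn_tsum_nat hu' fun d x hx =>
      (norm_norm (f (d + 1) x)).trans_le (hbound _ x hx),
      tendstoUniformlyOn_tsum_nat hu' fun d x hx => hbound _ x hx⟩

theorem convergesAbsUnifOnCompacts_integral_pow_div_factorial [IsProbabilityMeasure μ]
    {T : X → Y → ℂ} (hT : Continuous T.uncurry) {e : ℕ → ℕ} (he : e.Injective) :
    ConvergesAbsUnifOnCompacts fun d x => ∫ y, T x y ^ e d / (e d).factorial ∂μ := by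
  refine convergesAbsUnifOnCompacts_of_bound fun K hK => ?_
  obtain ⟨C, hC⟩ := (hK.prod isCompact_univ).exists_bound_of_continuousOn hT.continuousOn
  refine ⟨fun d => C ^ e d / (e d).factorial,
    (Real.summable_pow_div_factorial C).comp_injective he, fun d x hx => ?_⟩
  refine (norm_integral_le_of_norm_le_const (.of_forall fun y => ?_)).trans_eq
    (by rw [probReal_univ, mul_one])
  rw [norm_div, norm_pow, Complex.norm_natCast]
  dsimp only
  gcongr
  exact hC (x, y) ⟨hx, trivial⟩

end Convergence

section Expansions

variable {N : ℕ} {A B : Matrix (Fin N) (Fin N) ℂ} {a b c : Fin N → ℂ}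

theorem hasSum_hcizTerm (hN : 0 < N) (z : ℂ) (ha : IsEigenvalueList A a)
    (hb : IsEigenvalueList B b) :
    HasSum (fun d => hcizTerm N d (z, a, b)) (hciz N z A B) := by
  simp only [hcizTerm_eq_integral hN ha hb]
  refine hasSum_integral_pow_div_factorial (continuous_const.mul (Continuous.matrix_trace ?_))
  exact ((continuous_const.mul continuous_subtype_val).mul continuous_const).mul
    (continuous_subtype_val.comp continuous_inv)

theorem hasSum_bgwTerm (hN : 0 < N) (z : ℂ) (hc : IsEigenvalueList (A * B) c) :
    HasSum (fun d => bgwTerm N d (z, c)) (bgw N z A B) := by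
  have hexp := hasSum_integral_pow_div_factorial (μ := haarU N)
    (T := fun U => z * N * (A * U.1 + B * (U⁻¹).1).trace) <|
      continuous_const.mul ((continuous_const.mul continuous_subtype_val).add
        (continuous_const.mul (continuous_subtype_val.comp continuous_inv))).matrix_trace
  have hodd (n : ℕ) (hn : n ∉ Set.range (2 * ·)) :
      ∫ U : UGroup N, (z * N * (A * U.1 + B * (U⁻¹).1).trace) ^ n / n.factorial ∂haarU N = 0 := by
    rw [Set.mem_range, not_exists] at hn
    have hn' : Odd n := Nat.not_even_iff_odd.1 fun h => hn _ (Nat.two_mul_div_two_of_even h)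
    simp only [mul_pow _ (Matrix.trace _), mul_div_right_comm, integral_const_mul,
      integral_trace_add_pow_of_odd A B hn', mul_zero]
  simp only [bgwTerm_eq_integral hN hc]
  exact ((mul_right_injective₀ two_ne_zero).hasSum_iff hodd).2 hexp

theorem convergesAbsUnifOnCompacts_hcizTerm (hN : 0 < N) :
    ConvergesAbsUnifOnCompacts (hcizTerm N) := by
  have hT : Continuous (Function.uncurry fun (x : ℂ × (Fin N → ℂ) × (Fin N → ℂ))
      (U : UGroup N) => x.1 * N *
        (Matrix.diagonal x.2.1 * U.1 * Matrix.diagonal x.2.2 * (U⁻¹).1).trace) := by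
    simp only [Function.uncurry_def]
    fun_prop
  convert convergesAbsUnifOnCompacts_integral_pow_div_factorial (μ := haarU N) hT
    Function.injective_id using 3 with d x
  exact hcizTerm_eq_integral hN (Matrix.charpoly_diagonal x.2.1)
    (Matrix.charpoly_diagonal x.2.2) x.1 d

theorem convergesAbsUnifOnCompacts_bgwTerm (hN : 0 < N) :
    ConvergesAbsUnifOnCompacts (bgwTerm N) := by
  have hT : Continuous (Function.uncurry fun (x : ℂ × (Fin N → ℂ)) (U : UGroup N) =>
      x.1 * N * (Matrix.diagonal x.2 * U.1 + 1 * (U⁻¹).1).trace) := by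
    simp only [Function.uncurry_def]
    fun_prop
  convert convergesAbsUnifOnCompacts_integral_pow_div_factorial (μ := haarU N) hT
    (mul_right_injective₀ two_ne_zero) using 3 with d x
  refine bgwTerm_eq_integral hN ?_ x.1 d
  rw [mul_one]
  exact Matrix.charpoly_diagonal x.2

lemma eq_one_add_tsum_of_hasSum {f : ℕ → ℂ} {s : ℂ} (h : HasSum f s) (h0 : f 0 = 1) :
    s = 1 + ∑' d : ℕ, f (d + 1) := by
  rw [← h.tsum_eq, h.summable.tsum_eq_zero_add, h0]

end Expansions

end StringExpansion

end

theorem theorem1p2 (N : ℕ) (hN : 0 < N) :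
    (∀ (z : ℂ) (A B : Matrix (Fin N) (Fin N) ℂ) (a b : Fin N → ℂ),
      StringExpansion.IsEigenvalueList A a → StringExpansion.IsEigenvalueList B b →
        StringExpansion.hciz N z A B =
          1 + ∑' d : ℕ, StringExpansion.hcizTerm N (d + 1) (z, a, b)) ∧
    (∀ (z : ℂ) (A B : Matrix (Fin N) (Fin N) ℂ) (c : Fin N → ℂ),
      StringExpansion.IsEigenvalueList (A * B) c →
        StringExpansion.bgw N z A B =
          1 + ∑' d : ℕ, StringExpansion.bgwTerm N (d + 1) (z, c)) ∧
    StringExpansion.ConvergesAbsUnifOnCompacts (StringExpansion.hcizTerm N) ∧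
    StringExpansion.ConvergesAbsUnifOnCompacts (StringExpansion.bgwTerm N) := by
  refine ⟨fun z A B a b ha hb => ?_, fun z A B c hc => ?_,
    StringExpansion.convergesAbsUnifOnCompacts_hcizTerm hN,
    StringExpansion.convergesAbsUnifOnCompacts_bgwTerm hN⟩
  · refine StringExpansion.eq_one_add_tsum_of_hasSum
      (StringExpansion.hasSum_hcizTerm hN z ha hb) ?_
    simp [StringExpansion.hcizTerm_eq_integral hN ha hb]
  · refine StringExpansion.eq_one_add_tsum_of_hasSum
      (StringExpansion.hasSum_bgwTerm hN z hc) ?_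
    simp [StringExpansion.bgwTerm_eq_integral hN hc]
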